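/- For every $z\in\mathbb C^k$ let $\Gamma_z$ be a closed cone of $(1,0)$-vectors at $z$ that contains non-zero vectors, and assume that $\Gamma:=\bigcup_{z\in\mathbb C^k}\Gamma_z$ is closed (in the bundle of $(1,0)$-vectors, identified with $\mathbb C^k\times\mathbb C^k$). Let $$\mathcal P_\Gamma:=\{u\in\mathcal C^2(\mathbb C^k,\mathbb R):\ \langle i\partial\overline\partial u(z),\,i\xi_z\wedge\bar\xi_z\rangle\ge 0\ \text{ for every } z\in\mathbb C^k \text{ and every } \xi_z\in\Gamma_z\}.$$ A current $T$ of bidimension $(1,1)$ on $\mathbb C^k$ is called positive and $\Gamma$-directed if $T\ge 0$ and $T\wedge i\partial\overline\partial u\ge 0$ for every $u\in\mathcal P_\Gamma$. For a compact set $K\subset\mathbb C^k$ define the $\Gamma$-hull $$\widehat K_\Gamma:=\{z\in\mathbb C^k:\ u(z)\le \sup_K u\ \text{ for every } u\in\mathcal P_\Gamma\}.$$ Then $$\widehat K_\Gamma=\Big(\bigcup_T \operatorname{supp}(T)\Big)\cup K,$$ where the union is taken over all positive $\Gamma$-directed currents $T$ of bidimension $(1,1)$ on $\mathbb C^k$ with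 compact support such that $i\partial\overline\partial T\le 0$ on $\mathbb C^k\setminus K$. -/

import Mathlib

open scoped ComplexOrder ContDiff Distributions Topology
open Filter

noncomputable section

namespace GammaHull

/-- The space `ℂ^k` with its Euclidean norm. A `(1,0)`-vector `∑ j, ξ j • ∂/∂z_j` at a point is
represented by its coordinate vector `ξ`, which is again an element of this space. -/
abbrev Ck (k : ℕ) : Type := EuclideanSpace ℂ (Fin k)

/-- The value at one point of a complex `(1,1)`-form: the matrix `A` stands for
`∑ j, ∑ l, A j l • (i dz_j ∧ d\bar z_l)`. -/
abbrev Form11 (k : ℕ) : Type := Fin k → Fin k → ℂ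

variable {k : ℕ}

/-- `⟨A, i ξ ∧ \bar ξ⟩ = ∑ j, ∑ l, A j l ξ_j \bar ξ_l` for a `(1,0)`-vector `ξ`. -/
def Form11.eval (A : Form11 k) (ξ : Ck k) : ℂ :=
  ∑ j, ∑ l, A j l * ξ j * (starRingEnd ℂ) (ξ l)

/-- The Wirtinger operator `∂/∂z_j = (∂/∂x_j - i ∂/∂y_j) / 2`. -/
def wirtinger (j : Fin k) (f : Ck k → ℂ) (z : Ck k) : ℂ :=
  (fderiv ℝ f z (EuclideanSpace.single j 1)
    - Complex.I * fderiv ℝ f z (EuclideanSpace.single j Complex.I)) / 2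

/-- The Wirtinger operator `∂/∂\bar z_l = (∂/∂x_l + i ∂/∂y_l) / 2`. -/
def wirtingerBar (l : Fin k) (f : Ck k → ℂ) (z : Ck k) : ℂ :=
  (fderiv ℝ f z (EuclideanSpace.single l 1)
    + Complex.I * fderiv ℝ f z (EuclideanSpace.single l Complex.I)) / 2

/-- The `(1,1)`-form `i∂\bar∂u = ∑ j, ∑ l, (∂²u/∂z_j∂\bar z_l) i dz_j ∧ d\bar z_l`
of a real-valued function `u`. -/
def iddbar (u : Ck k → ℝ) (z : Ck k) : Form11 k :=
  fun j l => wirtinger j (wirtingerBar l (fun w => (u w : ℂ))) z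

/-- The cone `P_Γ` of `C²` functions `u` on `ℂ^k` with `⟨i∂\bar∂u(z), i ξ ∧ \bar ξ⟩ ≥ 0`
for all `z` and all `ξ ∈ Γ_z`. -/
def PGamma (Γ : Ck k → Set (Ck k)) : Set (Ck k → ℝ) :=
  {u | ContDiff ℝ 2 u ∧ ∀ z, ∀ ξ ∈ Γ z, 0 ≤ (iddbar u z).eval ξ}

/-- The hull of `K` with respect to `P_Γ`. The supremum is taken in `[-∞, ∞]`. -/
def hull (Γ : Ck k → Set (Ck k)) (K : Set (Ck k)) : Set (Ck k) :=
  {z | ∀ u ∈ PGamma Γ, (u z : EReal) ≤ ⨆ w ∈ K, (u w : EReal)}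

/-- Smooth compactly supported `(1,1)`-forms on `ℂ^k`. -/
abbrev TestForm (k : ℕ) : Type := 𝓓((⊤ : TopologicalSpace.Opens (Ck k)), Form11 k)

/-- Smooth compactly supported real functions on `ℂ^k`. -/
abbrev TestFun (k : ℕ) : Type := 𝓓((⊤ : TopologicalSpace.Opens (Ck k)), ℝ)

/-- Currents of bidimension `(1,1)` on `ℂ^k`: continuous `ℂ`-linear forms on the space of smooth
compactly supported `(1,1)`-forms, with its usual inductive limit topology. -/
abbrev Current (k : ℕ) : Type := TestForm k →L[ℂ] ℂ

theorem contDiff_wirtinger (j : Fin k) {f : Ck k → ℂ} (hf : ContDiff ℝ ∞ f) :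
    ContDiff ℝ ∞ (wirtinger j f) := by
  have h : ContDiff ℝ ∞ (fderiv ℝ f) := hf.fderiv_right (by simp)
  unfold wirtinger
  fun_prop

theorem contDiff_wirtingerBar (j : Fin k) {f : Ck k → ℂ} (hf : ContDiff ℝ ∞ f) :
    ContDiff ℝ ∞ (wirtingerBar j f) := by
  have h : ContDiff ℝ ∞ (fderiv ℝ f) := hf.fderiv_right (by simp)
  unfold wirtingerBar
  fun_prop

theorem contDiff_iddbar {u : Ck k → ℝ} (hu : ContDiff ℝ ∞ u) : ContDiff ℝ ∞ (iddbar u) := by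
  rw [contDiff_pi]
  intro j
  rw [contDiff_pi]
  intro l
  exact contDiff_wirtinger j (contDiff_wirtingerBar l (Complex.ofRealCLM.contDiff.comp hu))

theorem tsupport_wirtinger_subset (j : Fin k) (f : Ck k → ℂ) :
    tsupport (wirtinger j f) ⊆ tsupport f := by
  refine (closure_mono fun z hz => ?_).trans (tsupport_fderiv_subset ℝ (f := f))
  intro h
  exact hz (by simp [wirtinger, h])

theorem tsupport_wirtingerBar_subset (j : Fin k) (f : Ck k → ℂ) :
    tsupport (wirtingerBar j f) ⊆ tsupport f := by
  refine (closure_mono fun z hz => ?_).trans (tsupport_fderiv_subset ℝ (f := f))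
  intro h
  exact hz (by simp [wirtingerBar, h])

theorem tsupport_iddbar_subset (u : Ck k → ℝ) : tsupport (iddbar u) ⊆ tsupport u := by
  refine closure_minimal (fun z hz => ?_) (isClosed_tsupport u)
  by_contra h
  refine hz (funext fun j => funext fun l => ?_)
  have h1 : tsupport (fun w => (u w : ℂ)) ⊆ tsupport u :=
    closure_mono fun w hw hw' => hw (by simp [hw'])
  have h2 : wirtinger j (wirtingerBar l (fun w => (u w : ℂ))) z = 0 :=
    image_eq_zero_of_notMem_tsupport fun hz' =>
      h (h1 (tsupport_wirtingerBar_subset l _ (tsupport_wirtinger_subset j _ hz')))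
  exact h2

/-- `i∂\bar∂χ` as a test form, for a test function `χ`. -/
def iddbarTest (χ : TestFun k) : TestForm k where
  toFun := iddbar χ
  contDiff' := contDiff_iddbar χ.contDiff
  hasCompactSupport' := χ.hasCompactSupport.mono' ((subset_tsupport _).trans
    (tsupport_iddbar_subset χ))
  tsupport_subset' := fun _ _ => trivial

namespace Current

/-- Positivity: `⟨T, φ⟩ ≥ 0` for every test form `φ` that is positive at each point. -/
def IsPositive (T : Current k) : Prop :=
  ∀ φ : TestForm k, (∀ z ξ, 0 ≤ (φ z).eval ξ) → 0 ≤ T φ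

/-- The support of a current: the complement of the largest open set on which it vanishes. -/
def supp (T : Current k) : Set (Ck k) := Distribution.dsupport (T : TestForm k → ℂ)

/-- `⟨T, ψ⟩ = c`, where `ψ` is a continuous `(1,1)`-form with compact support and `T` is a current
of order zero (for instance a positive one): the value of the extension of `T` by continuity, that
is, `⟨T, φ n⟩ → c` for all smooth `φ n → ψ` uniformly with supports in a fixed compact set. -/
def HasPairing (T : Current k) (ψ : Ck k → Form11 k) (c : ℂ) : Prop :=
  ∀ φ : ℕ → TestForm k, (∃ L : Set (Ck k), IsCompact L ∧ ∀ n, tsupport (φ n) ⊆ L) →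
    TendstoUniformly (fun n => (φ n : Ck k → Form11 k)) ψ atTop →
      Tendsto (fun n => T (φ n)) atTop (𝓝 c)

/-- `T ∧ i∂\bar∂u ≥ 0` as a measure: `⟨T, χ i∂\bar∂u⟩` exists and is nonnegative for every test
function `χ ≥ 0`. Here `u` is of class `C²`, so that `i∂\bar∂u` is only continuous. -/
def WedgeNonneg (T : Current k) (u : Ck k → ℝ) : Prop :=
  ∀ χ : TestFun k, (∀ z, 0 ≤ χ z) →
    ∃ c : ℂ, 0 ≤ c ∧ T.HasPairing (fun z => (χ z : ℝ) • iddbar u z) c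

/-- The cone of positive `Γ`-directed currents of bidimension `(1,1)`:
`T ≥ 0` and `T ∧ i∂\bar∂u ≥ 0` for every `u` in `P_Γ`. -/
def IsPositiveDirected (Γ : Ck k → Set (Ck k)) (T : Current k) : Prop :=
  T.IsPositive ∧ ∀ u ∈ PGamma Γ, T.WedgeNonneg u

/-- `i∂\bar∂T ≤ 0` on `U`: `⟨i∂\bar∂T, χ⟩ = ⟨T, i∂\bar∂χ⟩ ≤ 0` for every test function `χ ≥ 0`
with compact support in `U`. -/
def IddbarNonposOn (T : Current k) (U : Set (Ck k)) : Prop :=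
  ∀ χ : TestFun k, (∀ z, 0 ≤ χ z) → tsupport χ ⊆ U → T (iddbarTest χ) ≤ 0

end Current

end GammaHull

end

/-! The currents on the right-hand side obey a maximum principle. If `z ∉ hull Γ K`, a small
multiple of `‖·‖²` turns a function of `P_Γ` separating `z` from `K` into a strictly
`Γ`-plurisubharmonic `p` with `p < m` on `K` and `m < p z`, and `v = max (p - m) 0 ^ 3` is a
nonnegative function of `P_Γ` vanishing near `K`. For a current `T` of the union, `T ∧ i∂\bar∂v` is
a positive measure whose mass `⟨i∂\bar∂T, v⟩` is nonpositive, hence it vanishes. Near `z` every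
small `C²` perturbation of `v` is still in `P_Γ`, so `T ∧ i∂\bar∂‖·‖² = 0` there, and positivity of
`T` gives `T = 0` near `z`.

Conversely let `z₀ ∈ hull Γ K`, and let `S` be the compact set of unit vectors, over a large ball
containing `K` and `z₀`, along which all functions of `P_Γ` have nonnegative Levi form. A `C²`
function whose Levi form is nonnegative on `S` and which is nonpositive on `K` is nonpositive at
`z₀`. The M. Riesz extension theorem turns this implication into a positive measure `ν` on `S` such
that `∫ ⟨i∂\bar∂u(z), iξ ∧ \bar ξ⟩ dν(z, ξ) = -u z₀` whenever `u = 0` on `K`. Integrating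
`(1,1)`-forms against `ν` defines a positive `Γ`-directed current `T` with `i∂\bar∂T = -δ_{z₀}`
off `K`; if `z₀ ∉ K`, it has `z₀` in its support.
-/

noncomputable section

namespace GammaHull

variable {k : ℕ}

/-! ### The second derivative and the Levi form -/

section Hessian

variable {E F : Type*} [NormedAddCommGroup E] [NormedSpace ℝ E] [NormedAddCommGroup F]
  [NormedSpace ℝ F]

/-- The second derivative of `u` at `z`, as a bilinear map. -/
def hessian (u : E → F) (z : E) : E →L[ℝ] E →L[ℝ] F := fderiv ℝ (fderiv ℝ u) z

theorem contDiff_one_fderiv {u : E → F} (hu : ContDiff ℝ 2 u) : ContDiff ℝ 1 (fderiv ℝ u) :=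
  hu.fderiv_right one_add_one_eq_two.le

theorem hasFDerivAt_fderiv {u : E → F} (hu : ContDiff ℝ 2 u) (z : E) :
    HasFDerivAt (fderiv ℝ u) (hessian u z) z :=
  ((contDiff_one_fderiv hu).differentiable one_ne_zero z).hasFDerivAt

theorem continuous_hessian {u : E → F} (hu : ContDiff ℝ 2 u) : Continuous (hessian u) :=
  (contDiff_one_fderiv hu).continuous_fderiv one_ne_zero

theorem exists_norm_hessian_le {u : E → F} (hu : ContDiff ℝ 2 u) (hc : HasCompactSupport u) :
    ∃ C : ℝ, ∀ z, ‖hessian u z‖ ≤ C := by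
  have hc_hessian : HasCompactSupport (hessian u) := (hc.fderiv ℝ).fderiv ℝ
  exact HasCompactSupport.exists_bound_of_continuous (E := E →L[ℝ] E →L[ℝ] F)
    (f := hessian u) hc_hessian (continuous_hessian hu)

theorem hessian_symm {u : E → F} (hu : ContDiff ℝ 2 u) (z v w : E) :
    hessian u z v w = hessian u z w v :=
  hu.contDiffAt.isSymmSndFDerivAt (by simp) v w

theorem hessian_congr {u v : E → F} {z : E} (h : u =ᶠ[𝓝 z] v) : hessian u z = hessian v z :=
  (h.fderiv (𝕜 := ℝ)).fderiv_eq

theorem hessian_add {u v : E → F} (hu : ContDiff ℝ 2 u) (hv : ContDiff ℝ 2 v) (z : E) :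
    hessian (u + v) z = hessian u z + hessian v z := by
  have h : fderiv ℝ (u + v) = fderiv ℝ u + fderiv ℝ v := funext fun w =>
    fderiv_add (hu.differentiable two_ne_zero w) (hv.differentiable two_ne_zero w)
  rw [hessian, h]
  exact ((hasFDerivAt_fderiv hu z).add (hasFDerivAt_fderiv hv z)).fderiv

theorem hessian_const_smul (c : ℝ) (u : E → F) (z : E) : hessian (c • u) z = c • hessian u z := by
  have h : fderiv ℝ (c • u) = c • fderiv ℝ u := funext fun w =>
    congrFun (fderiv_const_smul_field (𝕜 := ℝ) (f := u) c) w
  rw [hessian, h]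
  exact congrFun (fderiv_const_smul_field (𝕜 := ℝ) (f := fderiv ℝ u) c) z

theorem hessian_comp {h : ℝ → ℝ} (hh : ContDiff ℝ 2 h) {u : E → ℝ} (hu : ContDiff ℝ 2 u)
    (z v w : E) : hessian (h ∘ u) z v w
      = deriv h (u z) * hessian u z v w
        + deriv (deriv h) (u z) * fderiv ℝ u z v * fderiv ℝ u z w := by
  have hu₁ : Differentiable ℝ u := hu.differentiable two_ne_zero
  have hh₁ : Differentiable ℝ h := hh.differentiable two_ne_zero
  have hh₂ : Differentiable ℝ (deriv h) :=
    ((contDiff_succ_iff_deriv (n := 1)).mp hh).2.2.differentiable one_ne_zero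
  have h_first : fderiv ℝ (h ∘ u) = fun w => deriv h (u w) • fderiv ℝ u w := funext fun w =>
    ((hh₁ (u w)).hasDerivAt.comp_hasFDerivAt w (hu₁ w).hasFDerivAt).fderiv
  have h_coeff : HasFDerivAt (fun w => deriv h (u w)) (deriv (deriv h) (u z) • fderiv ℝ u z) z :=
    (hh₂ (u z)).hasDerivAt.comp_hasFDerivAt z (hu₁ z).hasFDerivAt
  rw [hessian, h_first, (h_coeff.fun_smul (hasFDerivAt_fderiv hu z)).fderiv]
  simp

theorem hessian_normSq {V : Type*} [NormedAddCommGroup V] [InnerProductSpace ℝ V] (z v w : V) :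
    hessian (fun x : V => ‖x‖ ^ 2) z v w = 2 * inner ℝ v w := by
  have h : fderiv ℝ (fun x : V => ‖x‖ ^ 2) = (2 : ℝ) • innerSL ℝ := by
    ext x v
    simp [(hasStrictFDerivAt_norm_sq x).hasFDerivAt.fderiv, two_smul]
  rw [hessian, h, ((2 : ℝ) • innerSL ℝ (E := V)).fderiv]
  rfl

end Hessian

section HermitianPart

variable {V : Type*} [NormedAddCommGroup V] [NormedSpace ℂ V] [NormedSpace ℝ V]
  [IsScalarTower ℝ ℂ V]

theorem complex_smul_eq (c : ℂ) (v : V) : c • v = c.re • v + c.im • Complex.I • v := by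
  rw [RCLike.real_smul_eq_coe_smul (K := ℂ) c.re, RCLike.real_smul_eq_coe_smul (K := ℂ) c.im,
    smul_smul, ← add_smul]
  exact congrArg (· • v) (Complex.re_add_im c).symm

theorem I_smul_complex_smul_eq (c : ℂ) (v : V) :
    Complex.I • c • v = c.re • Complex.I • v - c.im • v := by
  rw [smul_smul, complex_smul_eq]
  simp [sub_eq_neg_add]

/-- The sesquilinear form `4⁻¹ (B(v, w) + B(iv, iw) + i (B(v, iw) - B(iv, w)))` attached to a real
bilinear form `B`. When `B` is the second derivative of a function, its coefficients in the
standard basis are `∂²/∂z_j∂\bar z_l`. -/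
def hermitianPart (B : V →L[ℝ] V →L[ℝ] ℝ) : V →ₗ[ℂ] V →ₛₗ[starRingEnd ℂ] ℂ :=
  LinearMap.mk₂'ₛₗ (RingHom.id ℂ) (starRingEnd ℂ)
    (fun v w => ((B v w + B (Complex.I • v) (Complex.I • w) : ℝ)
      + Complex.I * (B v (Complex.I • w) - B (Complex.I • v) w : ℝ)) / 4)
    (fun v₁ v₂ w => by
      simp only [smul_add, map_add, add_apply]
      push_cast
      ring)
    (fun c v w => by
      rw [I_smul_complex_smul_eq, complex_smul_eq]
      apply Complex.ext <;> simp <;> ring)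
    (fun v w₁ w₂ => by
      simp only [smul_add, map_add]
      push_cast
      ring)
    (fun c v w => by
      rw [I_smul_complex_smul_eq, complex_smul_eq]
      apply Complex.ext <;> simp <;> ring)

theorem hermitianPart_apply (B : V →L[ℝ] V →L[ℝ] ℝ) (v w : V) :
    hermitianPart B v w = ((B v w + B (Complex.I • v) (Complex.I • w) : ℝ)
      + Complex.I * (B v (Complex.I • w) - B (Complex.I • v) w : ℝ)) / 4 :=
  rfl

theorem hermitianPart_self {B : V →L[ℝ] V →L[ℝ] ℝ} (hB : ∀ v w, B v w = B w v) (v : V) :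
    hermitianPart B v v = ((B v v + B (Complex.I • v) (Complex.I • v)) / 4 : ℝ) := by
  rw [hermitianPart_apply, hB v (Complex.I • v), sub_self]
  push_cast
  ring

end HermitianPart

theorem single_I_eq (j : Fin k) :
    (EuclideanSpace.single j Complex.I : Ck k) = Complex.I • EuclideanSpace.single j 1 := by
  ext i
  simp

/-- The `(1,1)`-form attached to a real bilinear form `B` on `ℂ^k`, as a function of `B`. -/
def hessianForm : (Ck k →L[ℝ] Ck k →L[ℝ] ℝ) →L[ℝ] Form11 k where
  toFun B j l := hermitianPart B (EuclideanSpace.single j 1) (EuclideanSpace.single l 1)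
  map_add' A B := by
    ext j l
    simp only [hermitianPart_apply, add_apply, Pi.add_apply]
    push_cast
    ring
  map_smul' c B := by
    ext j l
    simp only [hermitianPart_apply, smul_apply, Pi.smul_apply, smul_eq_mul, RingHom.id_apply,
      Complex.real_smul]
    push_cast
    ring
  cont := by
    simp only [hermitianPart_apply]
    fun_prop

theorem eval_hessianForm (B : Ck k →L[ℝ] Ck k →L[ℝ] ℝ) (ξ : Ck k) :
    (hessianForm B).eval ξ = hermitianPart B ξ ξ := by
  have hξ : ξ = ∑ j, ξ j • EuclideanSpace.single j (1 : ℂ) := by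
    ext i
    simp [Finset.sum_apply, Pi.single_apply]
  conv_rhs => rw [hξ]
  simp only [map_sum, map_smul, LinearMap.map_smulₛₗ, LinearMap.sum_apply, LinearMap.smul_apply,
    smul_eq_mul, Finset.mul_sum, Form11.eval]
  rw [Finset.sum_comm]
  refine Finset.sum_congr rfl fun l _ => Finset.sum_congr rfl fun j _ => ?_
  simp only [hessianForm, ContinuousLinearMap.coe_mk', LinearMap.coe_mk, AddHom.coe_mk]
  ring

theorem hasFDerivAt_wirtingerBar {u : Ck k → ℝ} (hu : ContDiff ℝ 2 u) (l : Fin k) (z : Ck k) :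
    HasFDerivAt (wirtingerBar l fun w => (u w : ℂ))
      ((2 : ℂ)⁻¹ • (Complex.ofRealCLM ∘L (hessian u z).flip (EuclideanSpace.single l 1)
        + Complex.I • Complex.ofRealCLM ∘L
          (hessian u z).flip (EuclideanSpace.single l Complex.I))) z := by
  have h_first (w v : Ck k) : fderiv ℝ (fun w => (u w : ℂ)) w v = fderiv ℝ u w v := by
    have h : HasFDerivAt (fun w => (u w : ℂ)) (Complex.ofRealCLM ∘L fderiv ℝ u w) w :=
      Complex.ofRealCLM.hasFDerivAt.comp w (hu.differentiable two_ne_zero w).hasFDerivAt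
    rw [h.fderiv]
    rfl
  have h_second (a : Ck k) : HasFDerivAt (fun w => (fderiv ℝ u w a : ℂ))
      (Complex.ofRealCLM ∘L (hessian u z).flip a) z :=
    Complex.ofRealCLM.hasFDerivAt.comp z
      (by simpa using (hasFDerivAt_fderiv hu z).clm_apply (hasFDerivAt_const a z))
  refine (((h_second (EuclideanSpace.single l 1)).add ((h_second (EuclideanSpace.single l
    Complex.I)).const_smul Complex.I)).const_smul (2 : ℂ)⁻¹).congr_of_eventuallyEq
    (Eventually.of_forall fun w => ?_)
  simp [wirtingerBar, h_first, div_eq_inv_mul]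

theorem iddbar_eq_hessianForm {u : Ck k → ℝ} (hu : ContDiff ℝ 2 u) (z : Ck k) :
    iddbar u z = hessianForm (hessian u z) := by
  ext j l
  simp only [iddbar, wirtinger, (hasFDerivAt_wirtingerBar hu l z).fderiv, hessianForm]
  simp only [single_I_eq]
  simp [hermitianPart_apply]
  linear_combination (-(1 / 4 : ℂ) * (hessian u z (Complex.I • EuclideanSpace.single j 1)
    (Complex.I • EuclideanSpace.single l 1) : ℂ)) * Complex.I_sq

/-- The Levi form of `u` at `z`, evaluated at the vector `ξ`. -/
def levi (u : Ck k → ℝ) (z ξ : Ck k) : ℝ :=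
  (hessian u z ξ ξ + hessian u z (Complex.I • ξ) (Complex.I • ξ)) / 4

theorem eval_iddbar {u : Ck k → ℝ} (hu : ContDiff ℝ 2 u) (z ξ : Ck k) :
    (iddbar u z).eval ξ = (levi u z ξ : ℂ) := by
  rw [iddbar_eq_hessianForm hu, eval_hessianForm, hermitianPart_self (hessian_symm hu z), levi]

theorem mem_PGamma_iff {Γ : Ck k → Set (Ck k)} {u : Ck k → ℝ} :
    u ∈ PGamma Γ ↔ ContDiff ℝ 2 u ∧ ∀ z, ∀ ξ ∈ Γ z, 0 ≤ levi u z ξ := by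
  refine and_congr_right fun hu => ?_
  simp_rw [eval_iddbar hu, Complex.zero_le_real]

theorem continuous_iddbar {u : Ck k → ℝ} (hu : ContDiff ℝ 2 u) : Continuous (iddbar u) := by
  rw [funext (iddbar_eq_hessianForm hu)]
  exact hessianForm.continuous.comp (continuous_hessian hu)

theorem continuous_levi {u : Ck k → ℝ} (hu : ContDiff ℝ 2 u) :
    Continuous fun p : Ck k × Ck k => levi u p.1 p.2 := by
  have h := continuous_hessian hu
  unfold levi
  fun_prop

theorem iddbar_congr {u v : Ck k → ℝ} (hu : ContDiff ℝ 2 u) (hv : ContDiff ℝ 2 v) {z : Ck k}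
    (h : u =ᶠ[𝓝 z] v) : iddbar u z = iddbar v z := by
  rw [iddbar_eq_hessianForm hu, iddbar_eq_hessianForm hv, hessian_congr h]

theorem iddbar_add {u v : Ck k → ℝ} (hu : ContDiff ℝ 2 u) (hv : ContDiff ℝ 2 v) (z : Ck k) :
    iddbar (u + v) z = iddbar u z + iddbar v z := by
  have h : ContDiff ℝ 2 (u + v) := hu.add hv
  rw [iddbar_eq_hessianForm hu, iddbar_eq_hessianForm hv, iddbar_eq_hessianForm h,
    hessian_add hu hv, map_add]

theorem iddbar_const_smul (c : ℝ) {u : Ck k → ℝ} (hu : ContDiff ℝ 2 u) (z : Ck k) :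
    iddbar (c • u) z = c • iddbar u z := by
  have h : ContDiff ℝ 2 (c • u) := hu.const_smul c
  rw [iddbar_eq_hessianForm hu, iddbar_eq_hessianForm h, hessian_const_smul, map_smul]

theorem levi_congr {u v : Ck k → ℝ} {z : Ck k} (h : u =ᶠ[𝓝 z] v) (ξ : Ck k) :
    levi u z ξ = levi v z ξ := by
  rw [levi, levi, hessian_congr h]

theorem levi_add {u v : Ck k → ℝ} (hu : ContDiff ℝ 2 u) (hv : ContDiff ℝ 2 v) (z ξ : Ck k) :
    levi (u + v) z ξ = levi u z ξ + levi v z ξ := by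
  simp only [levi, hessian_add hu hv, add_apply]
  ring

theorem levi_const_smul (c : ℝ) (u : Ck k → ℝ) (z ξ : Ck k) :
    levi (c • u) z ξ = c * levi u z ξ := by
  simp only [levi, hessian_const_smul, smul_apply, smul_eq_mul]
  ring

theorem levi_smul_right (u : Ck k → ℝ) (z ξ : Ck k) (t : ℝ) :
    levi u z (t • ξ) = t ^ 2 * levi u z ξ := by
  simp only [levi, smul_comm Complex.I t ξ, map_smul, smul_apply, smul_eq_mul]
  ring

theorem levi_comp {h : ℝ → ℝ} (hh : ContDiff ℝ 2 h) {u : Ck k → ℝ} (hu : ContDiff ℝ 2 u)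
    (z ξ : Ck k) : levi (h ∘ u) z ξ = deriv h (u z) * levi u z ξ
      + deriv (deriv h) (u z)
        * ((fderiv ℝ u z ξ) ^ 2 + (fderiv ℝ u z (Complex.I • ξ)) ^ 2) / 4 := by
  simp only [levi, hessian_comp hh hu]
  ring

theorem contDiff_normSq {n : ℕ∞ω} : ContDiff ℝ n fun z : Ck k => ‖z‖ ^ 2 :=
  contDiff_norm_sq ℝ

theorem levi_normSq (z ξ : Ck k) : levi (fun z => ‖z‖ ^ 2) z ξ = ‖ξ‖ ^ 2 := by
  simp only [levi, hessian_normSq, real_inner_self_eq_norm_sq, norm_smul, Complex.norm_I]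
  ring

theorem abs_levi_le (u : Ck k → ℝ) (z ξ : Ck k) : |levi u z ξ| ≤ ‖hessian u z‖ * ‖ξ‖ ^ 2 := by
  have h (v : Ck k) : |hessian u z v v| ≤ ‖hessian u z‖ * ‖v‖ ^ 2 := by
    simpa [pow_two, mul_assoc] using (hessian u z).le_opNorm₂ v v
  have h_I := h (Complex.I • ξ)
  rw [norm_smul, Complex.norm_I, one_mul] at h_I
  have h_nonneg : 0 ≤ ‖hessian u z‖ * ‖ξ‖ ^ 2 := by positivity
  rw [levi, abs_div, abs_of_pos (zero_lt_four' ℝ), div_le_iff₀ zero_lt_four]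
  linarith [h ξ, abs_add_le (hessian u z ξ ξ) (hessian u z (Complex.I • ξ) (Complex.I • ξ))]

theorem exists_abs_levi_le {u : Ck k → ℝ} (hu : ContDiff ℝ 2 u) (hc : HasCompactSupport u) :
    ∃ C : ℝ, 0 ≤ C ∧ ∀ z ξ, |levi u z ξ| ≤ C * ‖ξ‖ ^ 2 := by
  obtain ⟨C, hC⟩ := exists_norm_hessian_le hu hc
  refine ⟨max C 0, le_max_right C 0, fun z ξ => (abs_levi_le u z ξ).trans ?_⟩
  gcongr
  exact (hC z).trans (le_max_left C 0)

/-! ### The cube of the positive part -/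

/-- `t ↦ max(t, 0)³`: a convex increasing function of class `C²` vanishing exactly on `(-∞, 0]`,
used to truncate functions in `P_Γ`. -/
def posCube (t : ℝ) : ℝ := max t 0 ^ 3

theorem hasDerivAt_max_zero_pow (n : ℕ) (t : ℝ) :
    HasDerivAt (fun s : ℝ => max s 0 ^ (n + 2)) ((n + 2) * max t 0 ^ (n + 1)) t := by
  rcases lt_trichotomy t 0 with ht | rfl | ht
  · have h : (fun s : ℝ => max s 0 ^ (n + 2)) =ᶠ[𝓝 t] fun _ => 0 := by
      filter_upwards [Iio_mem_nhds ht] with s hs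
      simp [max_eq_right (le_of_lt (Set.mem_Iio.mp hs))]
    rw [max_eq_right ht.le]
    simpa using (hasDerivAt_const t (0 : ℝ)).congr_of_eventuallyEq h
  · have h_bound : (fun s : ℝ => max s 0 ^ (n + 2)) =O[𝓝 0] fun s : ℝ => s ^ (n + 2) := by
      refine Asymptotics.IsBigO.of_bound 1 (Eventually.of_forall fun s => ?_)
      rw [one_mul, norm_pow, norm_pow]
      gcongr
      rw [Real.norm_eq_abs, Real.norm_eq_abs, abs_of_nonneg (le_max_right _ _)]
      exact max_le (le_abs_self s) (abs_nonneg s)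
    have h_pow : (fun s : ℝ => s ^ (n + 2)) =o[𝓝 0] fun s : ℝ => s := by
      simpa using Asymptotics.isLittleO_pow_pow (𝕜 := ℝ) (show 1 < n + 2 by omega)
    rw [hasDerivAt_iff_isLittleO_nhds_zero]
    simpa using h_bound.trans_isLittleO h_pow
  · have h : (fun s : ℝ => max s 0 ^ (n + 2)) =ᶠ[𝓝 t] fun s => s ^ (n + 2) := by
      filter_upwards [Ioi_mem_nhds ht] with s hs
      simp [max_eq_left (le_of_lt (Set.mem_Ioi.mp hs))]
    rw [max_eq_left ht.le]
    simpa using (hasDerivAt_pow (n + 2) t).congr_of_eventuallyEq h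

theorem deriv_posCube : deriv posCube = fun t => 3 * max t 0 ^ 2 := by
  funext t
  refine (hasDerivAt_max_zero_pow 1 t).deriv.trans ?_
  norm_num

theorem deriv_deriv_posCube : deriv (deriv posCube) = fun t => 6 * max t 0 := by
  rw [deriv_posCube]
  funext t
  refine ((hasDerivAt_max_zero_pow 0 t).const_mul (3 : ℝ)).deriv.trans ?_
  norm_num
  ring

theorem contDiff_posCube : ContDiff ℝ 2 posCube := by
  have h₁ : Differentiable ℝ posCube := fun t => (hasDerivAt_max_zero_pow 1 t).differentiableAt
  have h₂ : Differentiable ℝ (deriv posCube) := by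
    rw [deriv_posCube]
    exact fun t => ((hasDerivAt_max_zero_pow 0 t).const_mul (3 : ℝ)).differentiableAt
  rw [← one_add_one_eq_two, contDiff_succ_iff_deriv]
  refine ⟨h₁, by simp, contDiff_one_iff_deriv.mpr ⟨h₂, ?_⟩⟩
  rw [deriv_deriv_posCube]
  fun_prop

theorem posCube_nonneg (t : ℝ) : 0 ≤ posCube t := pow_nonneg (le_max_right _ _) _

theorem posCube_of_nonpos {t : ℝ} (ht : t ≤ 0) : posCube t = 0 := by
  simp [posCube, max_eq_right ht]

theorem le_levi_posCube_sub {u : Ck k → ℝ} (hu : ContDiff ℝ 2 u) (c : ℝ) (z ξ : Ck k) :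
    3 * max (u z - c) 0 ^ 2 * levi u z ξ ≤ levi (fun w => posCube (u w - c)) z ξ := by
  have h_deriv : deriv (fun t => posCube (t - c)) = fun t => 3 * max (t - c) 0 ^ 2 := by
    funext t
    rw [deriv_comp_sub_const, deriv_posCube]
  have h_deriv₂ (t : ℝ) : deriv (deriv fun t => posCube (t - c)) t = 6 * max (t - c) 0 := by
    have h := congrFun deriv_deriv_posCube (t - c)
    rwa [← deriv_comp_sub_const, deriv_posCube, ← h_deriv] at h
  rw [show (fun w => posCube (u w - c)) = (fun t => posCube (t - c)) ∘ u from rfl,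
    levi_comp (h := fun t => posCube (t - c))
      (contDiff_posCube.comp (contDiff_id.sub contDiff_const)) hu,
    h_deriv₂, h_deriv]
  refine le_add_of_nonneg_right ?_
  positivity

/-! ### Mollification and cutoff functions -/

section Mollify

open MeasureTheory ContinuousLinearMap
open scoped Convolution

variable {E F : Type*} [NormedAddCommGroup E]

/-- A standard mollifying kernel, supported in the ball of radius `1 / (n + 1)`. -/
def mollifier (n : ℕ) : ContDiffBump (0 : E) where
  rIn := 1 / ((n : ℝ) + 1) / 2
  rOut := 1 / ((n : ℝ) + 1)
  rIn_pos := by positivity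
  rIn_lt_rOut := half_lt_self (by positivity)

theorem tendsto_mollifier_rOut :
    Tendsto (fun n => (mollifier n : ContDiffBump (0 : E)).rOut) atTop (𝓝 0) :=
  tendsto_one_div_add_atTop_nhds_zero_nat

variable [NormedSpace ℝ E] [FiniteDimensional ℝ E] [MeasurableSpace E] [BorelSpace E]
  [NormedAddCommGroup F] [NormedSpace ℝ F]

/-- The regularisation of `f` by convolution with the `n`-th mollifying kernel. -/
def mollify (n : ℕ) (f : E → F) : E → F :=
  (mollifier n).normed Measure.addHaar ⋆[lsmul ℝ ℝ, Measure.addHaar] f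

theorem contDiff_mollify (n : ℕ) {f : E → F} (hf : Continuous f) : ContDiff ℝ ∞ (mollify n f) :=
  (mollifier n).hasCompactSupport_normed.contDiff_convolution_left _
    (mollifier n).contDiff_normed hf.locallyIntegrable

theorem mollify_nonneg (n : ℕ) {f : E → ℝ} (hf : ∀ x, 0 ≤ f x) (x : E) : 0 ≤ mollify n f x :=
  integral_nonneg fun y => mul_nonneg ((mollifier n).nonneg_normed y) (hf _)

theorem eventually_mollify_eq_zero [CompleteSpace F] {f : E → F} {K : Set E} (hK : IsCompact K)
    (hf : ∀ᶠ x in 𝓝ˢ K, f x = 0) : ∀ᶠ n in atTop, ∀ᶠ x in 𝓝ˢ K, mollify n f x = 0 := by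
  obtain ⟨U, hU, hKU, hfU⟩ := eventually_nhdsSet_iff_exists.mp hf
  obtain ⟨δ, hδ, hδU⟩ := hK.exists_thickening_subset_open hU hKU
  filter_upwards [(tendsto_mollifier_rOut (E := E)).eventually_lt_const (half_pos hδ)] with n hn
  filter_upwards [Metric.isOpen_thickening.mem_nhdsSet.mpr
    (Metric.self_subset_thickening (half_pos hδ) K)] with x hx
  have h_ball (y : E) (hy : y ∈ Metric.ball x (mollifier n : ContDiffBump (0 : E)).rOut) :
      f y = 0 := by
    obtain ⟨w, hw, hxw⟩ := Metric.mem_thickening_iff.mp hx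
    refine hfU y (hδU (Metric.mem_thickening_iff.mpr ⟨w, hw, ?_⟩))
    linarith [dist_triangle y x w, Metric.mem_ball.mp hy]
  have hfx : f x = 0 := h_ball x (Metric.mem_ball_self (mollifier n).rOut_pos)
  rw [mollify, (mollifier n).normed_convolution_eq_right fun y hy => by rw [h_ball y hy, hfx], hfx]

theorem tendstoUniformly_mollify [CompleteSpace F] {f : E → F} (hf : Continuous f)
    (hc : HasCompactSupport f) : TendstoUniformly (fun n => mollify n f) f atTop := by
  rw [Metric.tendstoUniformly_iff]
  intro ε hε
  obtain ⟨δ, hδ, hδε⟩ :=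
    Metric.uniformContinuous_iff.mp (hc.uniformContinuous_of_continuous hf) (ε / 2) (half_pos hε)
  filter_upwards [(tendsto_mollifier_rOut (E := E)).eventually_lt_const hδ] with n hn x
  rw [dist_comm]
  refine lt_of_le_of_lt ((mollifier n).dist_normed_convolution_le hf.aestronglyMeasurable
    fun y hy => ?_) (half_lt_self hε)
  exact (hδε ((Metric.mem_ball.mp hy).trans hn)).le

theorem fderiv_mollify (n : ℕ) {f : E → F} (hf : ContDiff ℝ 1 f) (hc : HasCompactSupport f) :
    fderiv ℝ (mollify n f) = mollify n (fderiv ℝ f) := by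
  funext x
  exact (hc.hasFDerivAt_convolution_right (lsmul ℝ ℝ)
    ((mollifier n).contDiff_normed (n := 0)).continuous.locallyIntegrable hf x).fderiv

theorem tendstoUniformly_map_hessian_mollify [CompleteSpace F] {G : Type*}
    [NormedAddCommGroup G] [NormedSpace ℝ G] (L : (E →L[ℝ] E →L[ℝ] F) →L[ℝ] G) {f : E → F}
    (hf : ContDiff ℝ 2 f) (hc : HasCompactSupport f) :
    TendstoUniformly (fun n z => L (hessian (mollify n f) z)) (fun z => L (hessian f z)) atTop := by
  have h (n : ℕ) : hessian (mollify n f) = mollify n (hessian f) := by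
    unfold hessian
    rw [fderiv_mollify n (hf.of_le one_le_two) hc,
      fderiv_mollify n (contDiff_one_fderiv hf) (hc.fderiv ℝ)]
  have hc_hessian : HasCompactSupport (hessian f) := (hc.fderiv ℝ).fderiv ℝ
  simp_rw [h]
  have hL : UniformContinuous L :=
    ContinuousLinearMap.uniformContinuous (E₁ := E →L[ℝ] E →L[ℝ] F) L
  exact hL.comp_tendstoUniformly <|
    tendstoUniformly_mollify (F := E →L[ℝ] E →L[ℝ] F) (f := hessian f)
    (continuous_hessian hf) hc_hessian

end Mollify

theorem tendstoUniformly_iddbar_mollify {f : Ck k → ℝ} (hf : ContDiff ℝ 2 f)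
    (hc : HasCompactSupport f) :
    TendstoUniformly (fun n => iddbar (mollify n f)) (iddbar f) atTop := by
  have h (n : ℕ) := funext <| iddbar_eq_hessianForm <|
    (contDiff_mollify n hf.continuous).of_le (m := 2) (by norm_cast)
  simp_rw [h, funext (iddbar_eq_hessianForm hf)]
  exact tendstoUniformly_map_hessian_mollify hessianForm hf hc

theorem tsupport_subset_compl_of_eventually {X F : Type*} [TopologicalSpace X] [Zero F]
    {f : X → F} {s : Set X} (h : ∀ᶠ x in 𝓝ˢ s, f x = 0) : tsupport f ⊆ sᶜ := fun _ hx hxs =>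
  notMem_tsupport_iff_eventuallyEq.mpr (h.filter_mono (nhds_le_nhdsSet hxs)) hx

section TestFunction

open TopologicalSpace Distribution

variable {E F : Type*} [NormedAddCommGroup E] [NormedSpace ℝ E] [NormedAddCommGroup F]
  [NormedSpace ℝ F]

/-- The product `χ f` of a test function and a smooth function, as a test function. -/
def smulTest (χ : 𝓓((⊤ : Opens E), ℝ)) (f : E → F) (hf : ContDiff ℝ ∞ f) :
    𝓓((⊤ : Opens E), F) where
  toFun z := χ z • f z
  contDiff' := χ.contDiff.smul hf
  hasCompactSupport' := χ.hasCompactSupport.smul_right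
  tsupport_subset' := fun _ _ => trivial

@[simp]
theorem smulTest_apply (χ : 𝓓((⊤ : Opens E), ℝ)) (f : E → F) (hf : ContDiff ℝ ∞ f) (z : E) :
    smulTest χ f hf z = χ z • f z :=
  rfl

theorem tsupport_smulTest_subset (χ : 𝓓((⊤ : Opens E), ℝ)) (f : E → F) (hf : ContDiff ℝ ∞ f) :
    tsupport (smulTest χ f hf) ⊆ tsupport χ :=
  tsupport_smul_subset_left _ _

theorem exists_cutoff [FiniteDimensional ℝ E] {C U : Set E} (hC : IsCompact C) (hU : IsOpen U)
    (hCU : C ⊆ U) :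
    ∃ χ : 𝓓((⊤ : Opens E), ℝ), tsupport χ ⊆ U ∧ (∀ᶠ x in 𝓝ˢ C, χ x = 1) ∧ ∀ x, 0 ≤ χ x := by
  obtain ⟨L, hL, hCL, hLU⟩ := exists_compact_between hC hU hCU
  obtain ⟨f, hf_one, hf_zero, hf_mem⟩ := exists_contMDiffMap_one_nhds_of_subset_interior
    (n := ⊤) (modelWithCornersSelf ℝ E) hC.isClosed hCL
  have hfL : tsupport f ⊆ L :=
    closure_minimal (fun x hx => by_contra fun h => hx (hf_zero x h)) hL.isClosed
  exact ⟨⟨f, f.contMDiff.contDiff, hL.of_isClosed_subset (isClosed_tsupport _) hfL,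
    fun _ _ => trivial⟩, hfL.trans hLU, hf_one, fun x => (hf_mem x).1⟩

variable [FiniteDimensional ℝ E] {V Φ : Type*} [AddCommGroup V]
  [FunLike Φ 𝓓((⊤ : Opens E), F) V] [AddMonoidHomClass Φ 𝓓((⊤ : Opens E), F) V]

theorem isVanishingOn_union {T : Φ} {U W : Set E} (hU : IsOpen U) (hW : IsOpen W)
    (hTU : IsVanishingOn T U) (hTW : IsVanishingOn T W) : IsVanishingOn T (U ∪ W) := by
  intro φ hφ
  obtain ⟨χ, hχU, hχ_one, -⟩ := exists_cutoff (φ.hasCompactSupport.diff hW) hU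
    fun x hx => (hφ hx.1).resolve_right hx.2
  have h_cut : T (smulTest χ φ φ.contDiff) = 0 := hTU _ ((tsupport_smulTest_subset _ _ _).trans hχU)
  have h_rest : T (φ - smulTest χ φ φ.contDiff) = 0 := by
    refine hTW _ fun x hx => by_contra fun hxW => ?_
    have hxφ : x ∈ tsupport φ := by
      refine closure_mono (Function.support_subset_iff'.mpr fun y hy => ?_) hx
      simp [Function.notMem_support.mp hy]
    refine tsupport_subset_compl_of_eventually (s := tsupport φ \ W) ?_ hx ⟨hxφ, hxW⟩
    filter_upwards [hχ_one] with y hy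
    simp [hy]
  rwa [map_sub, h_cut, sub_zero] at h_rest

theorem apply_eq_zero_of_tsupport_subset {T : Φ} {φ : 𝓓((⊤ : Opens E), F)}
    (h : tsupport φ ⊆ (dsupport T)ᶜ) : T φ = 0 := by
  suffices ∃ U, IsOpen U ∧ tsupport φ ⊆ U ∧ IsVanishingOn T U by
    obtain ⟨U, -, hU, hT⟩ := this
    exact hT φ hU
  refine φ.hasCompactSupport.induction_on
    (p := fun s => ∃ U, IsOpen U ∧ s ⊆ U ∧ IsVanishingOn T U) ?_ ?_ ?_ ?_
  · refine ⟨∅, isOpen_empty, subset_rfl, fun ψ hψ => ?_⟩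
    have hψ_zero : ψ = 0 := by
      ext1 x
      exact image_eq_zero_of_notMem_tsupport fun hx => hψ hx
    rw [hψ_zero, map_zero]
  · rintro s t hst ⟨U, hU, htU, hT⟩
    exact ⟨U, hU, hst.trans htU, hT⟩
  · rintro s t ⟨U, hU, hsU, hTU⟩ ⟨W, hW, htW, hTW⟩
    exact ⟨U ∪ W, hU.union hW, Set.union_subset_union hsU htW, isVanishingOn_union hU hW hTU hTW⟩
  · intro x hx
    obtain ⟨s, hs, hso, hxs⟩ := (notMem_dsupport_iff x).mp (h hx)
    exact ⟨s, mem_nhdsWithin_of_mem_nhds (hso.mem_nhds hxs), s, hso, subset_rfl, hs⟩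

theorem apply_congr_of_eventually {T : Φ} {φ ψ : 𝓓((⊤ : Opens E), F)}
    (h : ∀ᶠ x in 𝓝ˢ (dsupport T), φ x = ψ x) : T φ = T ψ := by
  rw [← sub_eq_zero, ← map_sub]
  refine apply_eq_zero_of_tsupport_subset (tsupport_subset_compl_of_eventually ?_)
  filter_upwards [h] with x hx
  simp [hx]

end TestFunction

/-! ### Pairing a current with `χ i∂\bar∂v` -/

theorem contDiff_two_of_smooth {E : Type*} [NormedAddCommGroup E] [NormedSpace ℝ E] {u : E → ℝ}
    (hu : ContDiff ℝ ∞ u) : ContDiff ℝ 2 u :=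
  hu.of_le (by norm_cast)

/-- The test form `χ i∂\bar∂g`. -/
def smulIddbar (χ : TestFun k) (g : Ck k → ℝ) (hg : ContDiff ℝ ∞ g) : TestForm k :=
  smulTest χ (iddbar g) (contDiff_iddbar hg)

@[simp]
theorem smulIddbar_apply (χ : TestFun k) (g : Ck k → ℝ) (hg : ContDiff ℝ ∞ g) (z : Ck k) :
    smulIddbar χ g hg z = χ z • iddbar g z :=
  rfl

theorem iddbar_mul_of_eventually_eq_one {θ v : Ck k → ℝ} (hθ : ContDiff ℝ 2 θ)
    (hv : ContDiff ℝ 2 v) {z : Ck k} (h : ∀ᶠ w in 𝓝 z, θ w = 1) :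
    iddbar (fun w => θ w * v w) z = iddbar v z := by
  refine iddbar_congr (hθ.mul hv) hv ?_
  filter_upwards [h] with w hw
  rw [hw, one_mul]

/-- The `n`-th regularisation of `θ v`: a smooth approximation of `v` where `θ = 1`. -/
def smoothing (θ : TestFun k) (v : Ck k → ℝ) (n : ℕ) : Ck k → ℝ :=
  mollify n fun z => θ z * v z

theorem contDiff_smoothing (θ : TestFun k) {v : Ck k → ℝ} (hv : Continuous v) (n : ℕ) :
    ContDiff ℝ ∞ (smoothing θ v n) :=
  contDiff_mollify n (θ.continuous.mul hv)

theorem tendstoUniformly_smul_of_abs_le {X G : Type*} [NormedAddCommGroup G] [NormedSpace ℝ G]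
    {χ : X → ℝ} {C : ℝ} (hχ : ∀ x, |χ x| ≤ C) {f : ℕ → X → G} {g : X → G}
    (h : TendstoUniformly f g atTop) :
    TendstoUniformly (fun n x => χ x • f n x) (fun x => χ x • g x) atTop := by
  rw [Metric.tendstoUniformly_iff] at h ⊢
  intro ε hε
  filter_upwards [h (ε / max C 1) (by positivity)] with n hn x
  calc dist (χ x • g x) (χ x • f n x)
      = |χ x| * dist (g x) (f n x) := by rw [dist_smul₀, Real.norm_eq_abs]
    _ ≤ max C 1 * dist (g x) (f n x) := by
        gcongr
        exact (hχ x).trans (le_max_left C 1)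
    _ < max C 1 * (ε / max C 1) := by
        gcongr
        exact hn x
    _ = ε := mul_div_cancel₀ ε (by positivity)

theorem exists_abs_testFun_le (χ : TestFun k) : ∃ C : ℝ, ∀ z, |χ z| ≤ C :=
  χ.hasCompactSupport.exists_bound_of_continuous χ.continuous

theorem exists_add_eq_smul_cutoff {S : Set (Ck k)} (hS : IsCompact S) (χ : TestFun k) :
    ∃ (C : ℝ) (Θ χ' : TestFun k), 0 ≤ C ∧ (∀ z, 0 ≤ Θ z) ∧ (∀ᶠ z in 𝓝ˢ S, Θ z = 1) ∧
      (∀ z, 0 ≤ χ' z) ∧ χ + χ' = C • Θ := by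
  obtain ⟨Θ, -, hΘ, hΘ_nonneg⟩ := exists_cutoff (hS.union χ.hasCompactSupport) isOpen_univ
    (Set.subset_univ _)
  obtain ⟨C, hC⟩ := exists_abs_testFun_le χ
  have hC_nonneg : 0 ≤ C := (abs_nonneg _).trans (hC 0)
  refine ⟨C, Θ, C • Θ - χ, hC_nonneg, hΘ_nonneg,
    hΘ.filter_mono (nhdsSet_mono Set.subset_union_left), fun z => ?_, add_sub_cancel χ _⟩
  change 0 ≤ C * Θ z - χ z
  by_cases hz : z ∈ tsupport χ
  · rw [hΘ.self_of_nhdsSet z (Or.inr hz), mul_one, sub_nonneg]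
    exact (le_abs_self _).trans (hC z)
  · rw [image_eq_zero_of_notMem_tsupport hz, sub_zero]
    exact mul_nonneg hC_nonneg (hΘ_nonneg z)

theorem tendstoUniformly_smul_iddbar_smoothing {χ θ : TestFun k} {v : Ck k → ℝ}
    (hv : ContDiff ℝ 2 v) (hθ : ∀ᶠ z in 𝓝ˢ (tsupport χ), θ z = 1) :
    TendstoUniformly (fun n z => χ z • iddbar (smoothing θ v n) z) (fun z => χ z • iddbar v z)
      atTop := by
  have hθ₂ := contDiff_two_of_smooth θ.contDiff
  have h_eq : (fun z => χ z • iddbar v z) = fun z => χ z • iddbar (fun w => θ w * v w) z := by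
    funext z
    by_cases hz : z ∈ tsupport χ
    · rw [iddbar_mul_of_eventually_eq_one hθ₂ hv (hθ.filter_mono (nhds_le_nhdsSet hz))]
    · rw [image_eq_zero_of_notMem_tsupport hz, zero_smul, zero_smul]
  obtain ⟨C, hC⟩ := exists_abs_testFun_le χ
  rw [h_eq]
  exact tendstoUniformly_smul_of_abs_le hC
    (tendstoUniformly_iddbar_mollify (hθ₂.mul hv) θ.hasCompactSupport.mul_right)

namespace Current

variable {T : Current k}

theorem HasPairing.tendsto_smoothing {χ θ : TestFun k} {v : Ck k → ℝ} {c : ℂ}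
    (h : T.HasPairing (fun z => χ z • iddbar v z) c) (hv : ContDiff ℝ 2 v)
    (hθ : ∀ᶠ z in 𝓝ˢ (tsupport χ), θ z = 1) :
    Tendsto (fun n => T (smulIddbar χ (smoothing θ v n) (contDiff_smoothing θ hv.continuous n)))
      atTop (𝓝 c) :=
  h _ ⟨tsupport χ, χ.hasCompactSupport, fun _ => tsupport_smulTest_subset _ _ _⟩
    (tendstoUniformly_smul_iddbar_smoothing hv hθ)

theorem HasPairing.unique {χ : TestFun k} {v : Ck k → ℝ} {c c' : ℂ} (hv : ContDiff ℝ 2 v)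
    (h : T.HasPairing (fun z => χ z • iddbar v z) c)
    (h' : T.HasPairing (fun z => χ z • iddbar v z) c') : c = c' := by
  obtain ⟨θ, -, hθ, -⟩ := exists_cutoff χ.hasCompactSupport isOpen_univ (Set.subset_univ _)
  exact tendsto_nhds_unique (h.tendsto_smoothing hv hθ) (h'.tendsto_smoothing hv hθ)

theorem HasPairing.sub_testForm {ψ : Ck k → Form11 k} {c : ℂ} (h : T.HasPairing ψ c)
    (β : TestForm k) : T.HasPairing (fun z => ψ z - β z) (c - T β) := by
  rintro φ ⟨L, hL, hφL⟩ hφ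
  have h_supp (n : ℕ) : tsupport (φ n + β : TestForm k) ⊆ L ∪ tsupport β :=
    (tsupport_add _ _).trans (Set.union_subset_union_left _ (hφL n))
  have h_unif : TendstoUniformly (fun n => (φ n + β : TestForm k)) ψ atTop := by
    rw [Metric.tendstoUniformly_iff] at hφ ⊢
    intro ε hε
    filter_upwards [hφ ε hε] with n hn z
    simpa [dist_eq_norm, sub_sub, add_comm] using hn z
  have h_lim := h (fun n => φ n + β) ⟨_, hL.union β.hasCompactSupport, h_supp⟩ h_unif
  simpa using h_lim.sub_const (T β)

theorem apply_smulIddbar_nonpos {K : Set (Ck k)} (hdd : T.IddbarNonposOn Kᶜ) {Θ : TestFun k}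
    (hΘ_nonneg : ∀ z, 0 ≤ Θ z) (hΘ : ∀ᶠ z in 𝓝ˢ T.supp, Θ z = 1) {g : Ck k → ℝ}
    (hg : ContDiff ℝ ∞ g) (hg_nonneg : ∀ z, 0 ≤ g z) (hgK : ∀ᶠ z in 𝓝ˢ K, g z = 0) :
    T (smulIddbar Θ g hg) ≤ 0 := by
  have h_eq : T (smulIddbar Θ g hg) = T (iddbarTest (smulTest Θ g hg)) := by
    refine apply_congr_of_eventually ?_
    filter_upwards [hΘ.eventually_nhdsSet] with z hz
    have h_iddbar : iddbar (smulTest Θ g hg) z = iddbar g z :=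
      iddbar_mul_of_eventually_eq_one (contDiff_two_of_smooth Θ.contDiff)
        (contDiff_two_of_smooth hg) hz
    rw [smulIddbar_apply, hz.self_of_nhds, one_smul]
    exact h_iddbar.symm
  rw [h_eq]
  refine hdd _ (fun z => mul_nonneg (hΘ_nonneg z) (hg_nonneg z))
    (tsupport_subset_compl_of_eventually ?_)
  filter_upwards [hgK] with z hz
  rw [smulTest_apply, hz, smul_zero]

theorem IsPositiveDirected.hasPairing_zero {Γ : Ck k → Set (Ck k)} {K : Set (Ck k)}
    (hT : T.IsPositiveDirected Γ) (h_supp : IsCompact T.supp) (hdd : T.IddbarNonposOn Kᶜ)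
    (hK : IsCompact K) {v : Ck k → ℝ} (hv : v ∈ PGamma Γ) (hv_nonneg : ∀ z, 0 ≤ v z)
    (hvK : ∀ᶠ z in 𝓝ˢ K, v z = 0) {χ : TestFun k} (hχ : ∀ z, 0 ≤ χ z) :
    T.HasPairing (fun z => χ z • iddbar v z) 0 := by
  obtain ⟨C, Θ, χ', hC, hΘ_nonneg, hΘ, hχ', h_add⟩ := exists_add_eq_smul_cutoff h_supp χ
  obtain ⟨θ, -, hθ, hθ_nonneg⟩ := exists_cutoff
    (χ.hasCompactSupport.union χ'.hasCompactSupport) isOpen_univ (Set.subset_univ _)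
  obtain ⟨c, hc, hcT⟩ := hT.2 v hv χ hχ
  obtain ⟨c', hc', hcT'⟩ := hT.2 v hv χ' hχ'
  have hg := contDiff_smoothing θ hv.1.continuous
  have h_lim := (hcT.tendsto_smoothing hv.1
    (hθ.filter_mono (nhdsSet_mono Set.subset_union_left))).add (hcT'.tendsto_smoothing hv.1
    (hθ.filter_mono (nhdsSet_mono Set.subset_union_right)))
  have h_sum (n : ℕ) : T (smulIddbar χ _ (hg n)) + T (smulIddbar χ' _ (hg n))
      = C * T (smulIddbar Θ _ (hg n)) := by
    rw [← map_add, ← smul_eq_mul, ← map_smul]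
    congr 1
    ext1 z
    have h_add_z : χ z + χ' z = C * Θ z := DFunLike.congr_fun h_add z
    calc χ z • iddbar (smoothing θ v n) z + χ' z • iddbar (smoothing θ v n) z
        = C • Θ z • iddbar (smoothing θ v n) z := by rw [← add_smul, h_add_z, mul_smul]
      _ = (C : ℂ) • Θ z • iddbar (smoothing θ v n) z := (Complex.coe_smul _ _).symm
  -- `Θ = 1` near the support of `T`, so `⟨T, Θ i∂\bar∂g⟩ = ⟨i∂\bar∂T, g⟩` for smooth `g`.
  have h_nonpos : c + c' ≤ 0 := by
    refine le_of_tendsto h_lim ?_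
    filter_upwards [eventually_mollify_eq_zero (f := fun z => θ z * v z) hK
      (hvK.mono fun z hz => by rw [hz, mul_zero])] with n hn
    rw [h_sum]
    exact mul_nonpos_of_nonneg_of_nonpos (Complex.zero_le_real.mpr hC)
      (apply_smulIddbar_nonpos hdd hΘ_nonneg hΘ (hg n)
        (mollify_nonneg n fun z => mul_nonneg (hθ_nonneg z) (hv_nonneg z)) hn)
  have hc_zero : c = 0 := le_antisymm ((le_add_of_nonneg_right hc').trans h_nonpos) hc
  exact hc_zero ▸ hcT

end Current

/-! ### Vanishing of positive currents -/

namespace Form11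

theorem eval_add (A B : Form11 k) (ξ : Ck k) : (A + B).eval ξ = A.eval ξ + B.eval ξ := by
  simp [eval, add_mul, Finset.sum_add_distrib]

theorem eval_neg (A : Form11 k) (ξ : Ck k) : (-A).eval ξ = -A.eval ξ := by
  simp [eval]

theorem eval_smul {R : Type*} [Monoid R] [DistribMulAction R ℂ] [IsScalarTower R ℂ ℂ] (c : R)
    (A : Form11 k) (ξ : Ck k) : (c • A).eval ξ = c • A.eval ξ := by
  simp [eval, Finset.smul_sum, smul_mul_assoc]

theorem norm_eval_le (A : Form11 k) (ξ : Ck k) : ‖A.eval ξ‖ ≤ k ^ 2 * ‖A‖ * ‖ξ‖ ^ 2 := by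
  have h (j l : Fin k) : ‖A j l * ξ j * (starRingEnd ℂ) (ξ l)‖ ≤ ‖A‖ * ‖ξ‖ ^ 2 := by
    rw [norm_mul, norm_mul, RCLike.norm_conj, pow_two, mul_assoc]
    gcongr
    · exact (norm_le_pi_norm (A j) l).trans (norm_le_pi_norm A j)
    · exact PiLp.norm_apply_le ξ j
    · exact PiLp.norm_apply_le ξ l
  calc ‖A.eval ξ‖ ≤ ∑ _ : Fin k, ∑ _ : Fin k, ‖A‖ * ‖ξ‖ ^ 2 :=
        (norm_sum_le _ _).trans (Finset.sum_le_sum fun j _ =>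
          (norm_sum_le _ _).trans (Finset.sum_le_sum fun l _ => h j l))
    _ = k ^ 2 * ‖A‖ * ‖ξ‖ ^ 2 := by
        simp only [Finset.sum_const, Finset.card_univ, Fintype.card_fin, nsmul_eq_mul]
        ring

/-- The Hermitian (that is, real) part `(A + A^*) / 2` of a `(1,1)`-form. -/
def herm (A : Form11 k) : Form11 k := fun j l => (A j l + (starRingEnd ℂ) (A l j)) / 2

theorem eval_herm (A : Form11 k) (ξ : Ck k) : A.herm.eval ξ = ((A.eval ξ).re : ℂ) := by
  have h : ∑ j, ∑ l, (starRingEnd ℂ) (A l j) * ξ j * (starRingEnd ℂ) (ξ l)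
      = (starRingEnd ℂ) (A.eval ξ) := by
    rw [Finset.sum_comm, eval]
    simp only [map_sum, map_mul, Complex.conj_conj]
    refine Finset.sum_congr rfl fun j _ => Finset.sum_congr rfl fun l _ => ?_
    ring
  rw [Complex.re_eq_add_conj, ← h, eval, eval, ← Finset.sum_add_distrib, Finset.sum_div]
  refine Finset.sum_congr rfl fun j _ => ?_
  rw [← Finset.sum_add_distrib, Finset.sum_div]
  refine Finset.sum_congr rfl fun l _ => ?_
  rw [herm]
  ring

theorem herm_add_I_smul_herm (A : Form11 k) :
    A.herm + Complex.I • herm (-Complex.I • A) = A := by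
  ext j l
  simp only [herm, Pi.add_apply, Pi.smul_apply, smul_eq_mul, neg_mul, map_neg, map_mul,
    Complex.conj_I, neg_neg]
  linear_combination (-(A j l) + (starRingEnd ℂ) (A l j)) / 2 * Complex.I_sq

end Form11

/-- The Hermitian part of a test form. -/
def hermTest (φ : TestForm k) : TestForm k where
  toFun z := (φ z).herm
  contDiff' := by
    have h (j l : Fin k) : ContDiff ℝ ∞ fun z => φ z j l :=
      contDiff_pi.mp (contDiff_pi.mp φ.contDiff j) l
    refine contDiff_pi.mpr fun j => contDiff_pi.mpr fun l => ?_
    exact ((h j l).add (Complex.conjCLE.contDiff.comp (h l j))).div_const 2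
  hasCompactSupport' := φ.hasCompactSupport.comp_left (g := Form11.herm)
    (by ext j l; simp [Form11.herm])
  tsupport_subset' := fun _ _ => trivial

theorem eval_hermTest (φ : TestForm k) (z ξ : Ck k) :
    (hermTest φ z).eval ξ = (((φ z).eval ξ).re : ℂ) :=
  (φ z).eval_herm ξ

theorem eval_smulIddbar {χ : TestFun k} {g : Ck k → ℝ} (hg : ContDiff ℝ ∞ g) (z ξ : Ck k) :
    (smulIddbar χ g hg z).eval ξ = (χ z * levi g z ξ : ℝ) := by
  rw [smulIddbar_apply, Form11.eval_smul, eval_iddbar (contDiff_two_of_smooth hg),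
    Complex.real_smul, Complex.ofReal_mul]

namespace Current

variable {T : Current k}

theorem IsPositive.apply_mono (hT : T.IsPositive) {φ ψ : TestForm k}
    (h : ∀ z ξ, (φ z).eval ξ ≤ (ψ z).eval ξ) : T φ ≤ T ψ := by
  rw [← sub_nonneg, ← map_sub]
  refine hT _ fun z ξ => ?_
  change 0 ≤ Form11.eval (ψ z - φ z) ξ
  rw [sub_eq_add_neg, Form11.eval_add, Form11.eval_neg, ← sub_eq_add_neg]
  exact sub_nonneg.mpr (h z ξ)

theorem IsPositive.apply_hermTest_eq_zero (hT : T.IsPositive) {β : TestForm k}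
    (hTβ : T β ≤ 0) (hβ : ∀ z ξ, 0 ≤ (β z).eval ξ) {φ : TestForm k}
    (hβφ : ∀ z ∈ tsupport φ, ∀ ξ, (β z).eval ξ = (‖ξ‖ ^ 2 : ℝ)) : T (hermTest φ) = 0 := by
  obtain ⟨C, hC⟩ := φ.hasCompactSupport.exists_bound_of_continuous φ.continuous
  have hC_nonneg : 0 ≤ C := (norm_nonneg _).trans (hC 0)
  set c : ℂ := ((k ^ 2 * C : ℝ) : ℂ)
  have hc : 0 ≤ c := Complex.zero_le_real.mpr (by positivity)
  have h_abs (z ξ : Ck k) : (|((φ z).eval ξ).re| : ℝ) ≤ c * (β z).eval ξ := by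
    by_cases hz : z ∈ tsupport φ
    · rw [hβφ z hz, ← Complex.ofReal_mul, Complex.real_le_real]
      refine (Complex.abs_re_le_norm _).trans ((Form11.norm_eval_le _ _).trans ?_)
      gcongr
      exact hC z
    · rw [image_eq_zero_of_notMem_tsupport hz, ← zero_smul ℂ (0 : Form11 k), Form11.eval_smul]
      simpa using mul_nonneg hc (hβ z ξ)
  have h_le {ψ : TestForm k}
      (hψ : ∀ z ξ, (ψ z).eval ξ ≤ (|((φ z).eval ξ).re| : ℝ)) : T ψ ≤ 0 := by
    refine (hT.apply_mono (ψ := c • β) fun z ξ => ?_).trans ?_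
    · exact (hψ z ξ).trans ((h_abs z ξ).trans_eq (Form11.eval_smul c (β z) ξ).symm)
    · rw [map_smul]
      exact mul_nonpos_of_nonneg_of_nonpos hc hTβ
  refine le_antisymm (h_le fun z ξ => ?_) (neg_nonpos.mp ?_)
  · rw [eval_hermTest, Complex.real_le_real]
    exact le_abs_self _
  · rw [← map_neg]
    refine h_le fun z ξ => ?_
    change (-hermTest φ z).eval ξ ≤ _
    rw [Form11.eval_neg, eval_hermTest, ← Complex.ofReal_neg, Complex.real_le_real]
    exact neg_le_abs _

theorem IsPositive.apply_eq_zero (hT : T.IsPositive) {β : TestForm k} (hTβ : T β ≤ 0)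
    (hβ : ∀ z ξ, 0 ≤ (β z).eval ξ) {φ : TestForm k}
    (hβφ : ∀ z ∈ tsupport φ, ∀ ξ, (β z).eval ξ = (‖ξ‖ ^ 2 : ℝ)) : T φ = 0 := by
  have h_decomp : φ = hermTest φ + Complex.I • hermTest (-Complex.I • φ) := by
    ext1 z
    exact (φ z).herm_add_I_smul_herm.symm
  have h_tsupport : tsupport (-Complex.I • φ : TestForm k) ⊆ tsupport φ :=
    tsupport_smul_subset_right (fun _ => -Complex.I) φ
  rw [h_decomp, map_add, map_smul, hT.apply_hermTest_eq_zero hTβ hβ hβφ,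
    hT.apply_hermTest_eq_zero hTβ hβ fun z hz => hβφ z (h_tsupport hz), smul_zero, add_zero]

end Current

/-! ### The maximum principle -/

theorem exists_add_smul_mem_PGamma {Γ : Ck k → Set (Ck k)} {v : Ck k → ℝ} (hv : v ∈ PGamma Γ)
    {q : TestFun k} {a : ℝ} (ha : 0 < a)
    (hva : ∀ z ∈ tsupport q, ∀ ξ ∈ Γ z, a * ‖ξ‖ ^ 2 ≤ levi v z ξ) :
    ∃ δ : ℝ, 0 < δ ∧ v + (-δ) • ⇑q ∈ PGamma Γ := by
  have hq := contDiff_two_of_smooth q.contDiff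
  obtain ⟨C, hC_nonneg, hC⟩ := exists_abs_levi_le hq q.hasCompactSupport
  obtain ⟨hv₂, hvΓ⟩ := mem_PGamma_iff.mp hv
  set δ := a / (C + 1)
  have hδ : 0 < δ := by positivity
  have hδC : δ * C ≤ a := by
    rw [div_mul_eq_mul_div, div_le_iff₀ (by positivity)]
    linarith
  have hδq : ContDiff ℝ 2 ((-δ) • ⇑q) := hq.const_smul (-δ)
  refine ⟨δ, hδ, mem_PGamma_iff.mpr ⟨hv₂.add hδq, fun z ξ hξ => ?_⟩⟩
  rw [levi_add hv₂ hδq, levi_const_smul]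
  by_cases hz : z ∈ tsupport q
  · have h_upper : δ * levi q z ξ ≤ a * ‖ξ‖ ^ 2 := calc
      δ * levi q z ξ ≤ δ * (C * ‖ξ‖ ^ 2) := by
        gcongr
        exact (le_abs_self _).trans (hC z ξ)
      _ = δ * C * ‖ξ‖ ^ 2 := by ring
      _ ≤ a * ‖ξ‖ ^ 2 := by gcongr
    linarith [hva z hz ξ hξ]
  · have hq_zero : levi q z ξ = 0 := by
      rw [levi_congr (v := (0 : ℝ) • ⇑q), levi_const_smul, zero_mul]
      filter_upwards [notMem_tsupport_iff_eventuallyEq.mp hz] with w hw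
      simpa using hw
    rw [hq_zero, mul_zero, add_zero]
    exact hvΓ z ξ hξ

namespace Current.IsPositiveDirected

variable {T : Current k} {Γ : Ck k → Set (Ck k)} {K : Set (Ck k)} {v : Ck k → ℝ}

theorem apply_smulIddbar_nonpos_of_pos_levi (hT : T.IsPositiveDirected Γ)
    (h_supp : IsCompact T.supp) (hdd : T.IddbarNonposOn Kᶜ) (hK : IsCompact K)
    (hv : v ∈ PGamma Γ) (hv_nonneg : ∀ z, 0 ≤ v z) (hvK : ∀ᶠ z in 𝓝ˢ K, v z = 0)
    {q : TestFun k} {a : ℝ} (ha : 0 < a)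
    (hva : ∀ z ∈ tsupport q, ∀ ξ ∈ Γ z, a * ‖ξ‖ ^ 2 ≤ levi v z ξ)
    {χ : TestFun k} (hχ : ∀ z, 0 ≤ χ z) : T (smulIddbar χ q q.contDiff) ≤ 0 := by
  obtain ⟨δ, hδ, hw⟩ := exists_add_smul_mem_PGamma hv ha hva
  have hq := contDiff_two_of_smooth q.contDiff
  have hδq : ContDiff ℝ 2 ((-δ) • ⇑q) := hq.const_smul (-δ)
  set β : TestForm k := smulIddbar χ q q.contDiff
  have h_eq : (fun z => χ z • iddbar v z - ((δ : ℂ) • β) z)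
      = fun z => χ z • iddbar (v + (-δ) • ⇑q) z := by
    funext z
    have h_coe : ((δ : ℂ) • β) z = χ z • δ • iddbar q z :=
      (Complex.coe_smul _ _).trans (smul_comm _ _ _)
    rw [iddbar_add hv.1 hδq, iddbar_const_smul _ hq, h_coe, neg_smul,
      ← sub_eq_add_neg, smul_sub]
  obtain ⟨c, hc, hcT⟩ := hT.2 _ hw χ hχ
  have h_pairing := (hT.hasPairing_zero h_supp hdd hK hv hv_nonneg hvK hχ).sub_testForm
    ((δ : ℂ) • β)
  rw [h_eq] at h_pairing
  rw [hcT.unique hw.1 h_pairing, map_smul, zero_sub, neg_nonneg] at hc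
  have h := smul_nonpos_of_nonneg_of_nonpos (inv_nonneg.mpr hδ.le) hc
  rwa [smul_eq_mul, Complex.real_smul, ← mul_assoc, ← Complex.ofReal_mul, inv_mul_cancel₀ hδ.ne',
    Complex.ofReal_one, one_mul] at h

theorem disjoint_supp_of_pos_levi (hT : T.IsPositiveDirected Γ)
    (h_supp : IsCompact T.supp) (hdd : T.IddbarNonposOn Kᶜ) (hK : IsCompact K)
    (hv : v ∈ PGamma Γ) (hv_nonneg : ∀ z, 0 ≤ v z) (hvK : ∀ᶠ z in 𝓝ˢ K, v z = 0)
    {U : Set (Ck k)} (hU : IsOpen U) {a : ℝ} (ha : 0 < a)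
    (hva : ∀ z ∈ U, ∀ ξ ∈ Γ z, a * ‖ξ‖ ^ 2 ≤ levi v z ξ) : Disjoint U T.supp := by
  refine Set.disjoint_left.mpr fun z hz => ?_
  obtain ⟨χ, hχU, hχ_one, hχ⟩ := exists_cutoff (isCompact_singleton (x := z)) hU
    (Set.singleton_subset_iff.mpr hz)
  obtain ⟨κ, hκU, hκ_one, -⟩ := exists_cutoff χ.hasCompactSupport hU hχU
  set q : TestFun k := smulTest κ (fun w => ‖w‖ ^ 2) contDiff_normSq
  have hq_levi (w ξ : Ck k) (hw : w ∈ tsupport χ) : levi q w ξ = ‖ξ‖ ^ 2 := by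
    rw [← levi_normSq w ξ]
    refine levi_congr ?_ ξ
    filter_upwards [hκ_one.filter_mono (nhds_le_nhdsSet hw)] with y hy
    rw [smulTest_apply, hy, one_smul]
  have h_nonpos := hT.apply_smulIddbar_nonpos_of_pos_levi h_supp hdd hK hv hv_nonneg hvK (q := q)
    ha (fun w hw => hva w (hκU (tsupport_smulTest_subset _ _ _ hw))) hχ
  have h_eval (w ξ : Ck k) : (smulIddbar χ q q.contDiff w).eval ξ = (χ w * ‖ξ‖ ^ 2 : ℝ) := by
    rw [eval_smulIddbar]
    by_cases hw : w ∈ tsupport χ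
    · rw [hq_levi w ξ hw]
    · rw [image_eq_zero_of_notMem_tsupport hw, zero_mul, zero_mul]
  rw [nhdsSet_singleton] at hχ_one
  obtain ⟨W, hχW, hW, hzW⟩ := eventually_nhds_iff.mp hχ_one
  refine (Distribution.notMem_dsupport_iff z).mpr ⟨W, fun φ hφ => ?_, hW, hzW⟩
  refine hT.1.apply_eq_zero h_nonpos (fun w ξ => ?_) fun w hw ξ => ?_
  · rw [h_eval, Complex.zero_le_real]
    exact mul_nonneg (hχ w) (sq_nonneg _)
  · rw [h_eval, hχW w (hφ hw), one_mul]

end Current.IsPositiveDirected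

theorem exists_strict_perturbation {Γ : Ck k → Set (Ck k)} {K : Set (Ck k)} (hK : IsCompact K)
    {u : Ck k → ℝ} (hu : u ∈ PGamma Γ) {z : Ck k} {c : ℝ} (hKc : ∀ w ∈ K, u w < c)
    (hcz : c < u z) :
    ∃ (p : Ck k → ℝ) (m a : ℝ), ContDiff ℝ 2 p ∧ 0 < a ∧
      (∀ w, ∀ ξ ∈ Γ w, a * ‖ξ‖ ^ 2 ≤ levi p w ξ) ∧ (∀ w ∈ K, p w < m) ∧ m < p z := by
  obtain ⟨R, hR⟩ := hK.isBounded.exists_norm_le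
  obtain ⟨hu₂, huΓ⟩ := mem_PGamma_iff.mp hu
  obtain ⟨m, hcm, hmz⟩ := exists_between hcz
  set a := (m - c) / (R ^ 2 + 1)
  have ha : 0 < a := div_pos (sub_pos.mpr hcm) (by positivity)
  have h_normSq : ContDiff ℝ 2 (a • fun w : Ck k => ‖w‖ ^ 2) := contDiff_normSq.const_smul a
  refine ⟨u + a • fun w => ‖w‖ ^ 2, m, a, hu₂.add h_normSq, ha, fun w ξ hξ => ?_, fun w hw => ?_,
    hmz.trans_le (le_add_of_nonneg_right (mul_nonneg ha.le (sq_nonneg _)))⟩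
  · rw [levi_add hu₂ h_normSq, levi_const_smul, levi_normSq]
    linarith [huΓ w ξ hξ]
  · have h_bound : a * ‖w‖ ^ 2 ≤ m - c := calc
      a * ‖w‖ ^ 2 ≤ a * (R ^ 2 + 1) := by
        gcongr
        linarith [pow_le_pow_left₀ (norm_nonneg w) (hR w hw) 2]
      _ = m - c := div_mul_cancel₀ _ (by positivity)
    change u w + a * ‖w‖ ^ 2 < m
    linarith [hKc w hw]

theorem notMem_hull_iff {Γ : Ck k → Set (Ck k)} {K : Set (Ck k)} {z : Ck k} :
    z ∉ hull Γ K ↔ ∃ u ∈ PGamma Γ, ∃ c : ℝ, (∀ w ∈ K, u w < c) ∧ c < u z := by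
  simp only [hull, Set.mem_ofPred_eq, not_forall, not_le, exists_prop]
  refine exists_congr fun u => and_congr_right fun _ => ⟨fun h => ?_, ?_⟩
  · obtain ⟨c, hKc, hcz⟩ := EReal.lt_iff_exists_real_btwn.mp h
    exact ⟨c, fun w hw => EReal.coe_lt_coe_iff.mp
      ((le_iSup₂ (f := fun w (_ : w ∈ K) => (u w : EReal)) w hw).trans_lt hKc),
      EReal.coe_lt_coe_iff.mp hcz⟩
  · rintro ⟨c, hKc, hcz⟩
    exact (iSup₂_le fun w hw => EReal.coe_le_coe_iff.mpr (hKc w hw).le).trans_lt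
      (EReal.coe_lt_coe_iff.mpr hcz)

theorem subset_hull (Γ : Ck k → Set (Ck k)) (K : Set (Ck k)) : K ⊆ hull Γ K :=
  fun z hz u _ => le_iSup₂ (f := fun w (_ : w ∈ K) => (u w : EReal)) z hz

theorem Current.IsPositiveDirected.supp_subset_hull {T : Current k} {Γ : Ck k → Set (Ck k)}
    {K : Set (Ck k)} (hT : T.IsPositiveDirected Γ) (h_supp : IsCompact T.supp)
    (hdd : T.IddbarNonposOn Kᶜ) (hK : IsCompact K) : T.supp ⊆ hull Γ K := by
  refine fun z hz => by_contra fun hz_hull => ?_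
  obtain ⟨u, hu, c, hKc, hcz⟩ := notMem_hull_iff.mp hz_hull
  obtain ⟨p, m, a, hp, ha, hpa, hKm, hmz⟩ := exists_strict_perturbation hK hu hKc hcz
  obtain ⟨m', hmm', hm'z⟩ := exists_between hmz
  set v : Ck k → ℝ := fun w => posCube (p w - m)
  have hv_levi (w ξ : Ck k) (hξ : ξ ∈ Γ w) :
      3 * max (p w - m) 0 ^ 2 * (a * ‖ξ‖ ^ 2) ≤ levi v w ξ := by
    refine le_trans ?_ (le_levi_posCube_sub hp m w ξ)
    gcongr
    exact hpa w ξ hξ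
  have hv : v ∈ PGamma Γ := mem_PGamma_iff.mpr
    ⟨contDiff_posCube.comp (hp.sub contDiff_const), fun w ξ hξ =>
      le_trans (by positivity) (hv_levi w ξ hξ)⟩
  have hvK : ∀ᶠ w in 𝓝ˢ K, v w = 0 := by
    filter_upwards [(isOpen_lt hp.continuous continuous_const).mem_nhdsSet.mpr hKm] with w hw
    exact posCube_of_nonpos (sub_nonpos.mpr (le_of_lt hw))
  refine Set.disjoint_left.mp (hT.disjoint_supp_of_pos_levi h_supp hdd hK hv
    (fun w => posCube_nonneg _) hvK (isOpen_lt continuous_const hp.continuous)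
    (a := 3 * (m' - m) ^ 2 * a)
    (mul_pos (mul_pos three_pos (pow_pos (sub_pos.mpr hmm') 2)) ha) fun w hw ξ hξ => ?_) hm'z hz
  have h_max : m' - m ≤ max (p w - m) 0 := le_max_of_le_left (sub_le_sub_right (le_of_lt hw) m)
  refine le_trans ?_ (hv_levi w ξ hξ)
  rw [mul_assoc]
  gcongr

/-! ### Duality -/

theorem exists_mem_PGamma_eqOn {Γ : Ck k → Set (Ck k)} {R : ℝ} (hR : 0 ≤ R) {u : Ck k → ℝ}
    (hu : ContDiff ℝ 2 u) (hΓ : ∀ z, ‖z‖ ≤ R + 1 → ∀ ξ ∈ Γ z, 0 ≤ levi u z ξ) :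
    ∃ v ∈ PGamma Γ, ∀ z, ‖z‖ ≤ R → v z = u z := by
  obtain ⟨χ, -, hχ, -⟩ := exists_cutoff (isCompact_closedBall (0 : Ck k) (R + 1)) isOpen_univ
    (Set.subset_univ _)
  set f : Ck k → ℝ := fun z => χ z * u z
  have hf : ContDiff ℝ 2 f := (contDiff_two_of_smooth χ.contDiff).mul hu
  have hfu (z : Ck k) (hz : ‖z‖ ≤ R + 1) : f =ᶠ[𝓝 z] u := by
    filter_upwards [hχ.filter_mono (nhds_le_nhdsSet (mem_closedBall_zero_iff.mpr hz))] with w hw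
    simp only [f, hw, one_mul]
  obtain ⟨A, hA_nonneg, hA⟩ := exists_abs_levi_le hf χ.hasCompactSupport.mul_right
  -- The barrier vanishes on the ball of radius `R`, and its Levi form is large outside the ball of
  -- radius `R + 1`.
  set g : Ck k → ℝ := fun z => posCube (‖z‖ ^ 2 - R ^ 2)
  have hg : ContDiff ℝ 2 (A • g) :=
    (contDiff_posCube.comp (contDiff_normSq.sub contDiff_const)).const_smul A
  have hg_levi (z ξ : Ck k) : 3 * max (‖z‖ ^ 2 - R ^ 2) 0 ^ 2 * ‖ξ‖ ^ 2 ≤ levi g z ξ :=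
    levi_normSq z ξ ▸ le_levi_posCube_sub contDiff_normSq (R ^ 2) z ξ
  refine ⟨f + A • g, mem_PGamma_iff.mpr ⟨hf.add hg, fun z ξ hξ => ?_⟩, fun z hz => ?_⟩
  · rw [levi_add hf hg, levi_const_smul]
    rcases le_or_gt ‖z‖ (R + 1) with hz | hz
    · rw [levi_congr (hfu z hz)]
      exact add_nonneg (hΓ z hz ξ hξ)
        (mul_nonneg hA_nonneg (le_trans (by positivity) (hg_levi z ξ)))
    · have h_coeff : 1 ≤ 3 * max (‖z‖ ^ 2 - R ^ 2) 0 ^ 2 := by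
        have h_max : 1 ≤ max (‖z‖ ^ 2 - R ^ 2) 0 := le_max_of_le_left (by nlinarith)
        nlinarith
      have h_large : A * ‖ξ‖ ^ 2 ≤ A * levi g z ξ := by
        gcongr
        exact (le_mul_of_one_le_left (sq_nonneg _) h_coeff).trans (hg_levi z ξ)
      linarith [(abs_le.mp (hA z ξ)).1]
  · have hg_zero : g z = 0 :=
      posCube_of_nonpos (sub_nonpos.mpr (pow_le_pow_left₀ (norm_nonneg z) hz 2))
    simp [hg_zero, (hfu z (by linarith)).self_of_nhds]

/-- The unit `(1,0)`-vectors over the closed ball of radius `R` along which every function of `P_Γ`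
has a nonnegative Levi form. They contain the unit vectors of `Γ` over that ball, and their defining
condition is closed, so that they form a compact set. -/
def unitDirections (Γ : Ck k → Set (Ck k)) (R : ℝ) : Set (Ck k × Ck k) :=
  {p | ‖p.1‖ ≤ R ∧ ‖p.2‖ = 1 ∧ ∀ u ∈ PGamma Γ, 0 ≤ levi u p.1 p.2}

theorem isCompact_unitDirections (Γ : Ck k → Set (Ck k)) (R : ℝ) :
    IsCompact (unitDirections Γ R) := by
  have h_eq : unitDirections Γ R = (Metric.closedBall 0 R ×ˢ Metric.sphere 0 1)
      ∩ ⋂ u ∈ PGamma Γ, {p | 0 ≤ levi u p.1 p.2} := by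
    ext p
    simp only [unitDirections, Set.mem_ofPred_eq, Set.mem_inter_iff, Set.mem_prod,
      mem_closedBall_zero_iff, mem_sphere_zero_iff_norm, Set.mem_iInter, and_assoc]
  have h_closed (u : Ck k → ℝ) (hu : u ∈ PGamma Γ) :
      IsClosed {p : Ck k × Ck k | 0 ≤ levi u p.1 p.2} :=
    isClosed_Ici.preimage (continuous_levi hu.1)
  rw [h_eq]
  exact ((isCompact_closedBall _ _).prod (isCompact_sphere _ _)).inter_right
    (isClosed_biInter h_closed)

theorem levi_nonneg_of_unitDirections {Γ : Ck k → Set (Ck k)} {R : ℝ} {u : Ck k → ℝ}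
    (hu : ∀ p ∈ unitDirections Γ R, 0 ≤ levi u p.1 p.2) {z : Ck k} (hz : ‖z‖ ≤ R) {ξ : Ck k}
    (hξ : ξ ∈ Γ z) : 0 ≤ levi u z ξ := by
  rcases eq_or_ne ξ 0 with rfl | hξ_ne
  · simp [levi]
  · have h_mem : (z, ‖ξ‖⁻¹ • ξ) ∈ unitDirections Γ R := by
      refine ⟨hz, by
        rw [norm_smul, norm_inv, norm_norm, inv_mul_cancel₀ (norm_ne_zero_iff.mpr hξ_ne)],
        fun v hv => ?_⟩
      rw [levi_smul_right]
      exact mul_nonneg (sq_nonneg _) ((mem_PGamma_iff.mp hv).2 z ξ hξ)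
    have h := hu _ h_mem
    rw [levi_smul_right] at h
    exact nonneg_of_mul_nonneg_right h (by positivity)

theorem nonpos_of_mem_hull {Γ : Ck k → Set (Ck k)} {K : Set (Ck k)} {z₀ : Ck k}
    (hz₀ : z₀ ∈ hull Γ K) {R : ℝ} (hKR : ∀ w ∈ K, ‖w‖ ≤ R) (hz₀R : ‖z₀‖ ≤ R) {u : Ck k → ℝ}
    (hu : ContDiff ℝ 2 u) (hu_levi : ∀ p ∈ unitDirections Γ (R + 1), 0 ≤ levi u p.1 p.2)
    (huK : ∀ w ∈ K, u w ≤ 0) : u z₀ ≤ 0 := by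
  obtain ⟨v, hv, hvu⟩ := exists_mem_PGamma_eqOn ((norm_nonneg z₀).trans hz₀R) hu
    fun z hz ξ hξ => levi_nonneg_of_unitDirections hu_levi hz hξ
  by_contra! h_pos
  refine notMem_hull_iff.mpr ⟨v, hv, u z₀ / 2, fun w hw => ?_, ?_⟩ hz₀
  · rw [hvu w (hKR w hw)]
    linarith [huK w hw]
  · rw [hvu z₀ hz₀R]
    exact half_lt_self h_pos

theorem exists_levi_eq_of_norm_le {a : ℝ} (ha : 0 ≤ a) (b R : ℝ) :
    ∃ u : Ck k → ℝ, ContDiff ℝ 2 u ∧ (∀ z ξ, levi u z ξ = a * ‖ξ‖ ^ 2) ∧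
      ∀ z, ‖z‖ ≤ R → u z ≤ b := by
  have h_normSq : ContDiff ℝ 2 (a • fun z : Ck k => ‖z‖ ^ 2) := contDiff_normSq.const_smul a
  refine ⟨(a • fun z => ‖z‖ ^ 2) + fun _ => b - a * R ^ 2, h_normSq.add contDiff_const,
    fun z ξ => ?_, fun z hz => ?_⟩
  · have h_const : levi (fun _ : Ck k => b - a * R ^ 2) z ξ = 0 := by simp [levi, hessian]
    rw [levi_add h_normSq contDiff_const, levi_const_smul, levi_normSq, h_const, add_zero]
  · have h : a * ‖z‖ ^ 2 ≤ a * R ^ 2 := by gcongr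
    change a * ‖z‖ ^ 2 + (b - a * R ^ 2) ≤ b
    linarith

theorem exists_nonneg_comp_eq {V E : Type*} [AddCommGroup V] [Module ℝ V] [AddCommGroup E]
    [PartialOrder E] [IsOrderedAddMonoid E] [Module ℝ E] [PosSMulMono ℝ E] (A : V →ₗ[ℝ] E)
    (f : V →ₗ[ℝ] ℝ) (hf : ∀ v, 0 ≤ A v → 0 ≤ f v) (hA : ∀ y, ∃ v, y ≤ A v) :
    ∃ g : E →ₗ[ℝ] ℝ, (∀ y, 0 ≤ y → 0 ≤ g y) ∧ ∀ v, g (A v) = f v := by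
  -- M. Riesz extension on `V × E` from `V × 0`, for the cone where `A v + y ≥ 0`.
  set s : PointedCone ℝ (V × E) := (PointedCone.positive ℝ E).comap (A.coprod LinearMap.id)
  have mem_s {v : V} {y : E} : (v, y) ∈ s ↔ 0 ≤ A v + y := by simp [s]
  obtain ⟨g, hg_ext, hg_nonneg⟩ := riesz_extension s
    ⟨LinearMap.range (LinearMap.inl ℝ V E), (f ∘ₗ LinearMap.fst ℝ V E).domRestrict _⟩
    (by
      rintro ⟨_, v, rfl⟩ hv
      exact hf v (by simpa using mem_s.mp hv))
    (by
      rintro ⟨v, y⟩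
      obtain ⟨w, hw⟩ := hA (-(A v + y))
      refine ⟨⟨_, w, rfl⟩, mem_s.mpr ?_⟩
      simpa [add_assoc] using neg_le_iff_add_nonneg.mp hw)
  have hg_inl (v : V) : g (v, 0) = f v := hg_ext ⟨(v, 0), v, rfl⟩
  have h_le (v : V) : (g ∘ₗ LinearMap.inr ℝ V E) (A v) ≤ f v := by
    have h_graph : 0 ≤ g (v, -A v) := hg_nonneg _ (mem_s.mpr (add_neg_cancel _).ge)
    rw [← hg_inl, ← sub_nonneg, LinearMap.comp_apply, LinearMap.inr_apply, ← map_sub]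
    simpa using h_graph
  refine ⟨g ∘ₗ LinearMap.inr ℝ V E, fun y hy => hg_nonneg _ (mem_s.mpr (by simpa using hy)),
    fun v => le_antisymm (h_le v) ?_⟩
  simpa only [map_neg, neg_le_neg_iff] using h_le (-v)

/-- The real vector space of `C²` functions on `ℂ^k`. -/
def contDiffTwo (k : ℕ) : Submodule ℝ (Ck k → ℝ) where
  carrier := {u | ContDiff ℝ 2 u}
  zero_mem' := show ContDiff ℝ 2 (0 : Ck k → ℝ) from contDiff_const
  add_mem' {u v} (hu : ContDiff ℝ 2 u) (hv : ContDiff ℝ 2 v) := hu.add hv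
  smul_mem' c u (hu : ContDiff ℝ 2 u) := hu.const_smul c

theorem contDiffTwo.contDiff (u : contDiffTwo k) : ContDiff ℝ 2 u.1 := u.2

/-- The Levi form of a `C²` function on a set of `(1,0)`-vectors. -/
def leviRestrict (S : Set (Ck k × Ck k)) : contDiffTwo k →ₗ[ℝ] C(S, ℝ) where
  toFun u := ⟨fun s => levi u s.1.1 s.1.2,
    (continuous_levi (contDiffTwo.contDiff u)).comp continuous_subtype_val⟩
  map_add' u v := by
    ext s
    exact levi_add u.2 v.2 _ _
  map_smul' c u := by
    ext s
    exact levi_const_smul c _ _ _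

/-- The restriction of a `C²` function to a subset of `ℂ^k`. -/
def restrictContDiff (K : Set (Ck k)) : contDiffTwo k →ₗ[ℝ] C(K, ℝ) where
  toFun u := ⟨fun w => u.1 w, (contDiffTwo.contDiff u).continuous.comp continuous_subtype_val⟩
  map_add' _ _ := rfl
  map_smul' _ _ := rfl

open MeasureTheory in
theorem exists_measure_of_nonneg {X : Type*} [TopologicalSpace X] [CompactSpace X] [T2Space X]
    [MeasurableSpace X] [BorelSpace X] (g : C(X, ℝ) →ₗ[ℝ] ℝ) (hg : ∀ f, 0 ≤ f → 0 ≤ g f) :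
    ∃ ν : Measure X, IsFiniteMeasure ν ∧ ∀ f : C(X, ℝ), ∫ x, f x ∂ν = g f := by
  let Λ : CompactlySupportedContinuousMap X ℝ →ₚ[ℝ] ℝ := PositiveLinearMap.mk₀
    { toFun f := g f
      map_add' f h := map_add g (f : C(X, ℝ)) h
      map_smul' c f := map_smul g c (f : C(X, ℝ)) } fun f hf => hg _ hf
  exact ⟨RealRMK.rieszMeasure Λ, inferInstance, fun f => RealRMK.integral_rieszMeasure Λ
    (CompactlySupportedContinuousMap.continuousMapEquiv f)⟩

open MeasureTheory in
theorem exists_measure_of_mem_hull {Γ : Ck k → Set (Ck k)} {K : Set (Ck k)} (hK : IsCompact K)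
    {z₀ : Ck k} (hz₀ : z₀ ∈ hull Γ K) :
    ∃ (R : ℝ) (ν : Measure (unitDirections Γ R)), IsFiniteMeasure ν ∧
      ∀ u : Ck k → ℝ, ContDiff ℝ 2 u → (∀ w ∈ K, u w = 0) →
        ∫ s, levi u s.1.1 s.1.2 ∂ν = -u z₀ := by
  obtain ⟨R, hR⟩ := (hK.insert z₀).isBounded.exists_norm_le
  set S := unitDirections Γ (R + 1)
  have : CompactSpace S := isCompact_iff_compactSpace.mp (isCompact_unitDirections Γ (R + 1))
  have : CompactSpace K := isCompact_iff_compactSpace.mp hK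
  set A : contDiffTwo k →ₗ[ℝ] C(S, ℝ) × C(K, ℝ) := (leviRestrict S).prod (-restrictContDiff K)
  have h_nonneg (u : contDiffTwo k) (hu : 0 ≤ A u) : 0 ≤ -u.1 z₀ :=
    neg_nonneg.mpr (nonpos_of_mem_hull hz₀ (fun w hw => hR w (Or.inr hw)) (hR z₀ (Or.inl rfl))
      u.2 (fun p hp => hu.1 ⟨p, hp⟩) fun w hw => neg_nonneg.mp (hu.2 ⟨w, hw⟩))
  have h_cofinal (y : C(S, ℝ) × C(K, ℝ)) : ∃ u, y ≤ A u := by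
    obtain ⟨u, hu, hu_levi, huR⟩ := exists_levi_eq_of_norm_le (norm_nonneg y.1) (-‖y.2‖) R
    refine ⟨⟨u, hu⟩, fun s => ?_, fun w => ?_⟩
    · calc y.1 s ≤ ‖y.1‖ := y.1.apply_le_norm s
        _ = levi u s.1.1 s.1.2 := by rw [hu_levi, s.2.2.1, one_pow, mul_one]
    · exact (y.2.apply_le_norm w).trans (le_neg.mpr (huR w (hR w (Or.inr w.2))))
  obtain ⟨g, hg_nonneg, hgA⟩ := exists_nonneg_comp_eq A
    (-(LinearMap.proj z₀ ∘ₗ (contDiffTwo k).subtype)) h_nonneg h_cofinal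
  obtain ⟨ν, hν, hνg⟩ := exists_measure_of_nonneg (g ∘ₗ LinearMap.inl ℝ _ _)
    fun f hf => hg_nonneg _ ⟨hf, le_rfl⟩
  refine ⟨R + 1, ν, hν, fun u hu huK => ?_⟩
  have h_restrict : restrictContDiff K ⟨u, hu⟩ = 0 := by
    ext w
    exact huK w w.2
  have hA : A ⟨u, hu⟩ = (leviRestrict S ⟨u, hu⟩, 0) :=
    Prod.ext rfl (neg_eq_zero.mpr h_restrict)
  calc ∫ s, levi u s.1.1 s.1.2 ∂ν = g (leviRestrict S ⟨u, hu⟩, 0) := hνg (leviRestrict S ⟨u, hu⟩)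
    _ = -u z₀ := hA ▸ hgA ⟨u, hu⟩

/-! ### The current defined by a measure on unit vectors -/

theorem Form11.continuous_eval {X : Type*} [TopologicalSpace X] {ψ : X → Form11 k} {ξ : X → Ck k}
    (hψ : Continuous ψ) (hξ : Continuous ξ) : Continuous fun x => (ψ x).eval (ξ x) := by
  unfold Form11.eval
  fun_prop

section OfMeasure

open MeasureTheory
open scoped BoundedContinuousFunction

variable {S : Set (Ck k × Ck k)} (hS : ∀ s ∈ S, ‖s.2‖ = 1)

include hS in
theorem norm_eval_le_of_unit (ψ : Ck k →ᵇ Form11 k) (s : S) :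
    ‖(ψ s.1.1).eval s.1.2‖ ≤ k ^ 2 * ‖ψ‖ := by
  refine (Form11.norm_eval_le _ _).trans ?_
  rw [hS s s.2, one_pow, mul_one]
  gcongr
  exact ψ.norm_coe_le_norm _

variable (ν : Measure S) [IsFiniteMeasure ν]

include hS in
theorem integrable_eval (ψ : Ck k →ᵇ Form11 k) :
    Integrable (fun s : S => (ψ s.1.1).eval s.1.2) ν := by
  have h : Continuous fun s : S => (ψ s.1.1).eval s.1.2 :=
    Form11.continuous_eval (by fun_prop) (by fun_prop)
  exact .of_bound h.aestronglyMeasurable _ (.of_forall (norm_eval_le_of_unit hS ψ))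

/-- Integration of `⟨ψ(z), iξ ∧ \bar ξ⟩` against a finite measure `ν` on a set of pairs `(z, ξ)`
with `‖ξ‖ = 1`, as a functional of the bounded continuous form `ψ`. -/
def integralEval : (Ck k →ᵇ Form11 k) →L[ℂ] ℂ :=
  LinearMap.mkContinuous
    { toFun ψ := ∫ s, (ψ s.1.1).eval s.1.2 ∂ν
      map_add' φ ψ := by
        simp only [BoundedContinuousFunction.add_apply, Form11.eval_add]
        exact integral_add (integrable_eval hS ν φ) (integrable_eval hS ν ψ)
      map_smul' c ψ := by
        simp only [BoundedContinuousFunction.smul_apply, Form11.eval_smul]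
        exact integral_smul c _ }
    (k ^ 2 * ν.real Set.univ) fun ψ =>
      (norm_integral_le_of_norm_le_const (.of_forall (norm_eval_le_of_unit hS ψ))).trans_eq
        (mul_right_comm _ _ _)

namespace Current

/-- The current `φ ↦ ∫ ⟨φ(z), iξ ∧ \bar ξ⟩ dν(z, ξ)` defined by a finite measure `ν` on a set of
pairs `(z, ξ)` with `‖ξ‖ = 1`. -/
def ofMeasure : Current k :=
  (integralEval hS ν).comp (TestFunction.toBoundedContinuousFunctionCLM ℂ)

theorem ofMeasure_apply (φ : TestForm k) :
    ofMeasure hS ν φ = ∫ s, (φ s.1.1).eval s.1.2 ∂ν :=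
  rfl

theorem ofMeasure_of_eval_eq {φ : TestForm k} {f : Ck k → Ck k → ℝ}
    (h : ∀ z ξ, (φ z).eval ξ = f z ξ) : ofMeasure hS ν φ = (∫ s, f s.1.1 s.1.2 ∂ν : ℝ) := by
  rw [ofMeasure_apply, ← integral_complex_ofReal]
  simp_rw [h]

theorem hasPairing_ofMeasure (ψ : Ck k →ᵇ Form11 k) :
    (ofMeasure hS ν).HasPairing ψ (integralEval hS ν ψ) := fun _ _ hφ =>
  ((integralEval hS ν).continuous.tendsto ψ).comp
    (BoundedContinuousFunction.tendsto_iff_tendstoUniformly.mpr hφ)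

theorem isPositive_ofMeasure : (ofMeasure hS ν).IsPositive := fun φ hφ => by
  have h_real (z ξ : Ck k) : (φ z).eval ξ = (((φ z).eval ξ).re : ℂ) :=
    Complex.ext rfl (Complex.le_def.mp (hφ z ξ)).2.symm
  rw [ofMeasure_of_eval_eq hS ν h_real, Complex.zero_le_real]
  exact integral_nonneg fun s => (Complex.le_def.mp (hφ _ _)).1

theorem wedgeNonneg_ofMeasure {u : Ck k → ℝ} (hu : ContDiff ℝ 2 u)
    (hSu : ∀ s ∈ S, 0 ≤ levi u s.1 s.2) : (ofMeasure hS ν).WedgeNonneg u := by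
  intro χ hχ
  have h_cont : Continuous fun z => χ z • iddbar u z := χ.continuous.smul (continuous_iddbar hu)
  have h_supp : HasCompactSupport fun z => χ z • iddbar u z := χ.hasCompactSupport.smul_right
  obtain ⟨C, hC⟩ := h_supp.exists_bound_of_continuous h_cont
  let ψ : Ck k →ᵇ Form11 k := .ofNormedAddCommGroup _ h_cont C hC
  refine ⟨_, ?_, hasPairing_ofMeasure hS ν ψ⟩
  have h_eval (s : S) : (ψ s.1.1).eval s.1.2 = (χ s.1.1 * levi u s.1.1 s.1.2 : ℝ) := by
    change (χ s.1.1 • iddbar u s.1.1).eval s.1.2 = _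
    rw [Form11.eval_smul, eval_iddbar hu, Complex.real_smul, Complex.ofReal_mul]
  change 0 ≤ ∫ s, (ψ s.1.1).eval s.1.2 ∂ν
  simp_rw [h_eval]
  rw [integral_complex_ofReal, Complex.zero_le_real]
  exact integral_nonneg fun s => mul_nonneg (hχ _) (hSu s s.2)

theorem ofMeasure_iddbarTest (χ : TestFun k) :
    ofMeasure hS ν (iddbarTest χ) = (∫ s, levi χ s.1.1 s.1.2 ∂ν : ℝ) :=
  ofMeasure_of_eval_eq hS ν (eval_iddbar (contDiff_two_of_smooth χ.contDiff))

theorem supp_ofMeasure_subset {A : Set (Ck k)} (hA : IsClosed A) (hSA : ∀ s ∈ S, s.1 ∈ A) :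
    (ofMeasure hS ν).supp ⊆ A := by
  refine fun z => not_imp_not.mp fun hzA => (Distribution.notMem_dsupport_iff z).mpr
    ⟨Aᶜ, fun φ hφ => ?_, hA.isOpen_compl, hzA⟩
  rw [ofMeasure_apply]
  refine integral_eq_zero_of_ae (.of_forall fun s => ?_)
  simp [image_eq_zero_of_notMem_tsupport fun h => hφ h (hSA s s.2), Form11.eval]

end Current

end OfMeasure

theorem Current.mem_supp_of_iddbarTest_ne_zero {T : Current k} {U : Set (Ck k)} (hU : IsOpen U)
    {z₀ : Ck k} (hz₀ : z₀ ∈ U)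
    (hT : ∀ χ : TestFun k, tsupport χ ⊆ U → χ z₀ = 1 → T (iddbarTest χ) ≠ 0) : z₀ ∈ T.supp := by
  by_contra h
  obtain ⟨W, hW_zero, hW, hz₀W⟩ := (Distribution.notMem_dsupport_iff z₀).mp h
  obtain ⟨χ, hχ, hχ_one, -⟩ := exists_cutoff (isCompact_singleton (x := z₀)) (hW.inter hU)
    (Set.singleton_subset_iff.mpr ⟨hz₀W, hz₀⟩)
  rw [nhdsSet_singleton] at hχ_one
  exact hT χ (hχ.trans Set.inter_subset_right) hχ_one.self_of_nhds
    (hW_zero _ ((tsupport_iddbar_subset χ).trans (hχ.trans Set.inter_subset_left)))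

theorem exists_current_of_mem_hull {Γ : Ck k → Set (Ck k)} {K : Set (Ck k)} (hK : IsCompact K)
    {z₀ : Ck k} (hz₀ : z₀ ∈ hull Γ K) (hz₀K : z₀ ∉ K) :
    ∃ T : Current k, (T.IsPositiveDirected Γ ∧ IsCompact T.supp ∧ T.IddbarNonposOn Kᶜ) ∧
      z₀ ∈ T.supp := by
  obtain ⟨R, ν, hν, hνK⟩ := exists_measure_of_mem_hull hK hz₀
  set T : Current k := .ofMeasure (fun s hs => hs.2.1) ν
  have h_supp : T.supp ⊆ Metric.closedBall 0 R :=
    Current.supp_ofMeasure_subset _ ν Metric.isClosed_closedBall fun s hs =>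
      mem_closedBall_zero_iff.mpr hs.1
  have h_iddbar (χ : TestFun k) (hχ : tsupport χ ⊆ Kᶜ) : T (iddbarTest χ) = (-χ z₀ : ℝ) := by
    rw [Current.ofMeasure_iddbarTest, hνK χ (contDiff_two_of_smooth χ.contDiff)]
    exact fun w hw => image_eq_zero_of_notMem_tsupport fun h => hχ h hw
  refine ⟨T, ⟨⟨Current.isPositive_ofMeasure _ ν, fun u hu =>
    Current.wedgeNonneg_ofMeasure _ ν hu.1 fun s hs => hs.2.2 u hu⟩, ?_, fun χ hχ hχK => ?_⟩, ?_⟩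
  · exact (isCompact_closedBall 0 R).of_isClosed_subset Distribution.isClosed_dsupport h_supp
  · rw [h_iddbar χ hχK, ← Complex.ofReal_zero, Complex.real_le_real]
    exact neg_nonpos.mpr (hχ z₀)
  · refine Current.mem_supp_of_iddbarTest_ne_zero hK.isClosed.isOpen_compl hz₀K
      fun χ hχK hχ => ?_
    rw [h_iddbar χ hχK, hχ]
    norm_num

end GammaHull

end

theorem corollary3p5_general {k : ℕ} (Γ : GammaHull.Ck k → Set (GammaHull.Ck k))
    (K : Set (GammaHull.Ck k)) (hK : IsCompact K) :
    GammaHull.hull Γ K =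
      (⋃ T ∈ {T : GammaHull.Current k | T.IsPositiveDirected Γ ∧ IsCompact T.supp ∧
        T.IddbarNonposOn Kᶜ}, T.supp) ∪ K := by
  refine Set.Subset.antisymm (fun z hz => ?_) (Set.union_subset
    (Set.iUnion₂_subset fun T hT => hT.1.supp_subset_hull hT.2.1 hT.2.2 hK)
    (GammaHull.subset_hull Γ K))
  refine or_iff_not_imp_right.mpr fun hzK => ?_
  obtain ⟨T, hT, hzT⟩ := GammaHull.exists_current_of_mem_hull hK hz hzK
  exact Set.mem_iUnion₂.mpr ⟨T, hT, hzT⟩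

theorem corollary3p5 {k : ℕ} (Γ : GammaHull.Ck k → Set (GammaHull.Ck k))
    (hΓcone : ∀ z, ∀ ξ ∈ Γ z, ∀ t : ℝ, 0 < t → t • ξ ∈ Γ z)
    (hΓne : ∀ z, ∃ ξ ∈ Γ z, ξ ≠ 0)
    (hΓclosed : IsClosed {p : GammaHull.Ck k × GammaHull.Ck k | p.2 ∈ Γ p.1})
    (K : Set (GammaHull.Ck k)) (hK : IsCompact K) :
    GammaHull.hull Γ K =
      (⋃ T ∈ {T : GammaHull.Current k | T.IsPositiveDirected Γ ∧ IsCompact T.supp ∧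
        T.IddbarNonposOn Kᶜ}, T.supp) ∪ K :=
  corollary3p5_general Γ K hK
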